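/- **Setting.** Let $\Omega\subset\mathbb R$ be a bounded interval with non-empty interior (in particular, any bounded domain in $\mathbb R$). For $m\in\mathbb N_0$ let $C^m(\Omega)$ be the space of $m$ times continuously differentiable functions on $\Omega$ with bounded derivatives up to order $m$, with norm $\|g\|_{C^m(\Omega)}=\sum_{j\le m}\sup_{u\in\Omega}|g^{(j)}(u)|$; $C^m(\Omega\times\Omega)$ is understood likewise. Let $p\in\mathbb N$, $p\ge1$. For $s,\lambda>0$ let $g_{s,\lambda}(r)=s^2\exp(-r^2/(2\lambda^2))$ be the Gaussian kernel. Let $k:\Omega\times\Omega\to\mathbb R$ be one of the following kernels. * (Warping) $k(u,v)=g_{s,\lambda}(w(u)-w(v))$ with $s,\lambda>0$ and $w\in C^{2p}(\Omega)$ injective. * (Mixture) $k(u,v)=\sum_{\ell=1}^L\sigma_\ell(u)\sigma_\ell(v)\,g_{s_\ell,\lambda_\ell}(u-v)$ with $s_\ell,\lambda_\ell>0$ and $\sigma_\ell\in C^{2p}(\Omega)$, such that $k$ is positive definite on $\Omega$. * (Convolution) $k(u,v)=\dfrac{2^{1/2}a(u)^{1/4}a(v)^{1/4}}{(a(u)+a(v))^{1/2}}\;g_{s,\lambda}\!\left(\dfrac{|u-v|}{\sqrt{(a(u)+a(v))/2}}\right)$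 with $s,\lambda>0$, $a\in C^{2p}(\Omega)$ and $a(u)\ge c>0$ for all $u\in\Omega$. Positive definite means $\sum_{i,j}c_ic_jk(u_i,u_j)>0$ for pairwise distinct $u_i\in\Omega$ and $c\ne0$. Put $$C(k)=\sup\bigl\{|D^{\alpha_1,\alpha_2}k(u_1,u_2)| : \alpha_1+\alpha_2=2p,\ u_1,u_2\in\Omega\bigr\},$$ where $D^{\alpha_1,\alpha_2}$ takes $\alpha_1$ derivatives in the first and $\alpha_2$ in the second variable. Let $B_{2p}$ be the Bell number (the number of partitions of a set of $2p$ elements), and for a number $C_0$ let $E(k)$ be, for the warping, mixture and convolution kernel respectively, $$C_0\,s^2\sqrt{(2p)!}\,B_{2p}\,\|w\|_{C^{2p}(\Omega)},\qquad C_0\,2p\,2^{4p}\sqrt{(2p)!}\,\max_{\ell}\|\sigma_\ell\|_{C^{2p}(\Omega)}^2,$$ $$2^{1/2}s^2\Bigl(|5/4-2p|^{2p}\max\{\|a\|_{C^0(\Omega)},1\}^{1/4-2p}\|a\|_{C^{2p}(\Omega)}\Bigr)^2(4p)!\,2C_0\sqrt{(2p)!}\,\|a\|_{C^{2p}(\Omega)}^2\,(2p)!\,(2c)^{-1-2p}\,\|a\|_{C^{2p}(\Omega)}\,B_{2p}^5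 .$$ Let $\mathcal H_k(\Omega)$ be the reproducing kernel Hilbert space of $k$. For $f\in\mathcal H_k(\Omega)$, $N\ge1$ and distinct points $U_N=\{u_1,\dots,u_N\}\subset\Omega$, the noise-free posterior mean is $m_N(u)=k(u,U_N)^{T}K^{-1}f(U_N)$, where $k(u,U_N)=(k(u,u_n))_n$, $K=(k(u_i,u_j))_{i,j}$ and $f(U_N)=(f(u_n))_n$; the fill distance is $h=\sup_{u\in\Omega}\min_n|u-u_n|$. **Statement.** There is an absolute constant $0<C_0\le1.0866$ for which the following holds. Every $k$ as above is positive definite on $\Omega$ and lies in $C^{2p}(\Omega\times\Omega)$ (so $C(k)<\infty$), and $\mathcal H_k(\Omega)\subset C^p(\Omega)$ in the sense of $p$-fold continuous differentiability. There is $h_0>0$, independent of $f$, $N$ and $U_N$, such that for all $f\in\mathcal H_k(\Omega)$, all $N\ge1$, all $U_N$ with $h\le h_0$, and all integers $0\le\mu<p$, $$\|D^\mu f-D^\mu m_N\|_{C^0(\Omega)}\le C(k)\,h^{p-\mu}\,\|f\|_{\mathcal H_k(\Omega)},$$ and the same estimate holds with $C(k)$ replaced by the explicit constant $E(k)$. Moreover,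 there are $A,h_1>0$ depending only on $\Omega$ and $p$ (not on $k$, $f$, $N$, $U_N$) such that the estimate holds with $C(k)$ replaced by $A\sqrt{C(k)}$ for all $U_N$ with $h\le h_1$. -/

import Mathlib

universe u

noncomputable section

/-! ### Function spaces on a set of real numbers -/

/-- `g ∈ C^m(Ω)`: `g` is `m` times continuously differentiable on `Ω` and the derivatives of order
at most `m` are bounded on `Ω`. All derivatives are taken within `Ω`; on an open set they are the
usual ones, at an end point of an interval they are one-sided. -/
def IsCm (Ω : Set ℝ) (m : ℕ) (g : ℝ → ℝ) : Prop :=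
  ContDiffOn ℝ m g Ω ∧
    ∀ j ≤ m, BddAbove {x : ℝ | ∃ u ∈ Ω, x = |iteratedDerivWithin j g Ω u|}

/-- The norm `‖g‖_{C^m(Ω)} = ∑_{j ≤ m} sup_{u ∈ Ω} |g^{(j)}(u)|`. -/
def cNorm (Ω : Set ℝ) (m : ℕ) (g : ℝ → ℝ) : ℝ :=
  ∑ j ∈ Finset.range (m + 1), sSup {x : ℝ | ∃ u ∈ Ω, x = |iteratedDerivWithin j g Ω u|}

/-- The mixed derivative `D^{a,b} k (u, v)`: `b` derivatives in the second variable and `a`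
derivatives in the first one. -/
def mixedDeriv (Ω : Set ℝ) (a b : ℕ) (k : ℝ → ℝ → ℝ) (u v : ℝ) : ℝ :=
  iteratedDerivWithin a (fun x => iteratedDerivWithin b (fun y => k x y) Ω v) Ω u

/-- `k ∈ C^m(Ω × Ω)`: continuous differentiability of order `m`, with bounded derivatives. -/
def IsCm₂ (Ω : Set ℝ) (m : ℕ) (k : ℝ → ℝ → ℝ) : Prop :=
  ContDiffOn ℝ m (fun z : ℝ × ℝ => k z.1 z.2) (Ω ×ˢ Ω) ∧
    ∀ a b : ℕ, a + b ≤ m →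
      BddAbove {x : ℝ | ∃ u ∈ Ω, ∃ v ∈ Ω, x = |mixedDeriv Ω a b k u v|}

/-- The constant `C(k) = max_{a + b = 2p} sup_{u, v ∈ Ω} |D^{a,b} k (u, v)|`. -/
def derivConst (Ω : Set ℝ) (p : ℕ) (k : ℝ → ℝ → ℝ) : ℝ :=
  sSup {x : ℝ | ∃ a b : ℕ, a + b = 2 * p ∧
    ∃ u ∈ Ω, ∃ v ∈ Ω, x = |mixedDeriv Ω a b k u v|}

/-! ### Kernels -/

/-- Positive definiteness (strict, for pairwise distinct points) of a kernel on `Ω`. -/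
def IsPosDefKernel (Ω : Set ℝ) (k : ℝ → ℝ → ℝ) : Prop :=
  ∀ (n : ℕ) (u : Fin n → Ω), Function.Injective u → ∀ c : Fin n → ℝ, c ≠ 0 →
    0 < ∑ i, ∑ j, c i * c j * k (u i) (u j)

/-- The Gaussian kernel with marginal variance `s ^ 2` and correlation length `lam`, as a function
of the difference of the two arguments. -/
def gaussianKernel (s lam r : ℝ) : ℝ := s ^ 2 * Real.exp (-r ^ 2 / (2 * lam ^ 2))

/-- The warping kernel with warping function `w` and stationary kernel `ks`. -/
def warpKernel (w ks : ℝ → ℝ) (u v : ℝ) : ℝ := ks (w u - w v)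

/-- The kernel mixture with coefficients `σ ℓ` and stationary kernels `ks ℓ`. -/
def mixKernel {L : ℕ} (σ ks : Fin L → ℝ → ℝ) (u v : ℝ) : ℝ :=
  ∑ ℓ, σ ℓ u * σ ℓ v * ks ℓ (u - v)

/-- The convolution kernel in dimension one, with length scale function `a` and isotropic
kernel `ki`. -/
def convKernel (a ki : ℝ → ℝ) (u v : ℝ) : ℝ :=
  (2 : ℝ) ^ (1 / 2 : ℝ) * a u ^ (1 / 4 : ℝ) * a v ^ (1 / 4 : ℝ) / (a u + a v) ^ (1 / 2 : ℝ) *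
    ki (|u - v| / Real.sqrt ((a u + a v) / 2))

/-- The three constructions of a non-stationary kernel from Gaussian kernels, each with its
hyper-parameters: `s` (or `s ℓ`) is the marginal standard deviation and `lam` (or `lam ℓ`) the
correlation length of the Gaussian kernel; `c` is a lower bound for the length scale function `a`
of the convolution kernel. -/
inductive NonstatKernel : Type where
  | warp (s lam : ℝ) (w : ℝ → ℝ)
  | mix (L : ℕ) (s lam : Fin L → ℝ) (σ : Fin L → ℝ → ℝ)
  | conv (s lam c : ℝ) (a : ℝ → ℝ)

namespace NonstatKernel

/-- The kernel. -/
def kernel : NonstatKernel → ℝ → ℝ → ℝ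
  | warp s lam w => warpKernel w (gaussianKernel s lam)
  | mix _ s lam σ => mixKernel σ (fun ℓ => gaussianKernel (s ℓ) (lam ℓ))
  | conv s lam _ a => convKernel a (gaussianKernel s lam)

/-- The assumptions on the hyper-parameters: the parameters of the Gaussian kernels are positive
and the functional hyper-parameters lie in `C^{2p}(Ω)`; the warping function is injective;
the mixture is positive definite (as noise-free regression requires); and the length scale function
of the convolution kernel is bounded below by `c > 0`. -/
def Admissible (Ω : Set ℝ) (p : ℕ) : NonstatKernel → Prop
  | warp s lam w => 0 < s ∧ 0 < lam ∧ Set.InjOn w Ω ∧ IsCm Ω (2 * p) w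
  | mix L s lam σ => (∀ ℓ, 0 < s ℓ ∧ 0 < lam ℓ ∧ IsCm Ω (2 * p) (σ ℓ)) ∧
      IsPosDefKernel Ω (kernel (mix L s lam σ))
  | conv s lam c a => 0 < s ∧ 0 < lam ∧ 0 < c ∧ (∀ u ∈ Ω, c ≤ a u) ∧ IsCm Ω (2 * p) a

/-- The explicit constants in terms of `C^{2p}`-norms of the hyper-parameters and of the Bell
number `B_{2p}` (`Nat.bell`); `C₀` is a numerical constant. -/
def explicitConst (C₀ : ℝ) (Ω : Set ℝ) (p : ℕ) : NonstatKernel → ℝ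
  | warp s _ w =>
      C₀ * s ^ 2 * Real.sqrt ((2 * p).factorial) * Nat.bell (2 * p) * cNorm Ω (2 * p) w
  | mix _ _ _ σ =>
      C₀ * (2 * p) * 2 ^ (4 * p) * Real.sqrt ((2 * p).factorial) *
        ⨆ ℓ, cNorm Ω (2 * p) (σ ℓ) ^ 2
  | conv s _ c a =>
      (2 : ℝ) ^ (1 / 2 : ℝ) * s ^ 2 *
        (|5 / 4 - 2 * (p : ℝ)| ^ (2 * p) *
          max (cNorm Ω 0 a) 1 ^ (1 / 4 - 2 * (p : ℝ)) * cNorm Ω (2 * p) a) ^ 2 *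
        ((4 * p).factorial * 2 * C₀ * Real.sqrt ((2 * p).factorial) * cNorm Ω (2 * p) a ^ 2 *
          (2 * p).factorial * (2 * c) ^ (-1 - 2 * (p : ℝ)) * cNorm Ω (2 * p) a) *
        (Nat.bell (2 * p) : ℝ) ^ 5

end NonstatKernel

/-! ### Gaussian process regression -/

/-- The fill distance `sup_{u ∈ Ω} min_n |u - u_n|` of the points `U` in `Ω`. -/
def fillDistance (Ω : Set ℝ) {N : ℕ} (U : Fin N → Ω) : ℝ :=
  ⨆ u : Ω, ⨅ n : Fin N, |(u : ℝ) - U n|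

/-- The posterior mean `k(u, U)ᵀ (K(U, U) + δ² I)⁻¹ y` for the data `y` at the points `U`. -/
def posteriorMean {Ω : Set ℝ} (k : ℝ → ℝ → ℝ) (δ2 : ℝ) {N : ℕ} (U : Fin N → Ω)
    (y : Fin N → ℝ) (u : ℝ) : ℝ :=
  (fun n => k u (U n)) ⬝ᵥ
    (((Matrix.of fun i j => k (U i) (U j)) + δ2 • (1 : Matrix (Fin N) (Fin N) ℝ))⁻¹).mulVec y

/-- A function on `Ω`, extended by zero so that derivatives within `Ω` can be written down. -/
def extendZero (Ω : Set ℝ) (g : Ω → ℝ) : ℝ → ℝ := Function.extend Subtype.val g 0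

/-- For every `f` in the reproducing kernel Hilbert space `H` of `k` on `Ω`, we have `f ∈ C^p(Ω)`,
and the noise-free posterior mean `m` based on the values of `f` at `N ≥ 1` distinct points of `Ω`
with fill distance `h ≤ h₀` satisfies `‖D^μ f - D^μ m‖_{C^0(Ω)} ≤ C h^{p - μ} ‖f‖_H` for all
`μ < p`. -/
def NativeErrorBound (Ω : Set ℝ) (p : ℕ) (k : ℝ → ℝ → ℝ) (C h₀ : ℝ) : Prop :=
  ∀ (H : Type u) [NormedAddCommGroup H] [InnerProductSpace ℝ H] [CompleteSpace H]
    [RKHS ℝ H Ω ℝ], (∀ x y : Ω, RKHS.kernel H x y 1 = k x y) →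
  ∀ f : H, ContDiffOn ℝ p (extendZero Ω f) Ω ∧
    ∀ (N : ℕ) (U : Fin N → Ω), 0 < N → Function.Injective U → fillDistance Ω U ≤ h₀ →
    ∀ μ < p, ∀ x ∈ Ω,
      |iteratedDerivWithin μ (extendZero Ω f) Ω x -
          iteratedDerivWithin μ (posteriorMean k 0 U fun n => f (U n)) Ω x| ≤
        C * fillDistance Ω U ^ (p - μ) * ‖f‖

end

/-! The error `f - m` vanishes at the data sites, and its derivatives are controlled by the norm of
the native space. If `Φ` is the feature map, then `f x = ⟪Φ x, f⟫`. Difference quotients of `Φ` have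
inner products that are values of a mixed derivative of `k` (`exists_hasDerivWithinAt_featureMap`),
so `Φ` is differentiable as often as `k` is in each variable separately, and `D^j f x = ⟪Ψ j x, f⟫`
with `‖Ψ j x‖ ^ 2 = D^{j,j} k (x, x)`. The interpolant is an orthogonal projection, hence `‖f - m‖ ≤
‖f‖` (`exists_interpolant`).

Every point lies in an interval of length `4 (p + 1) h` inside `Ω` holding `p + 1` sites. By Rolle
each derivative of the error of order at most `p` has a zero there, and the mean value theorem
descends from a bound on the top derivative (`abs_chain_le_of_sites`). Top order `p` gives the rate
`h ^ (p - μ)` with constant `A * √C(k)`, since `D^{p,p} k (x, x) ≤ C(k)`.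

The kernels are built from functions of one variable, so they have `2p` derivatives in each variable
separately, and `p + 1 ≤ 2p`. Top order `p + 1` therefore gives one more factor `h`, and for `h`
small depending on `k` it absorbs any positive constant. For `C(k) > 0` and `E(k)` only positivity
matters; if `C(k) = 0`, the square-root bound is already zero.

Positive definiteness of the warping and convolution kernels comes from writing them as weighted
`L²` Gram kernels of Gaussian densities, which are linearly independent. -/

section

open Set Filter Topology

/-! ### Differentiability of feature maps. -/

/-- The mean value theorem for derivatives within an order-connected set. -/
lemma exists_sub_eq_mul_of_hasDerivWithinAt {Ω : Set ℝ} (hΩ : Ω.OrdConnected) {f f' : ℝ → ℝ}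
    (hf : ∀ x ∈ Ω, HasDerivWithinAt f (f' x) Ω x) {x y : ℝ} (hx : x ∈ Ω) (hy : y ∈ Ω) :
    ∃ ξ ∈ Ω, |ξ - x| ≤ |y - x| ∧ f y - f x = (y - x) * f' ξ := by
  have key : ∀ a ∈ Ω, ∀ b ∈ Ω, a < b → ∃ ξ ∈ Ioo a b, f b - f a = (b - a) * f' ξ := by
    intro a ha b hb hab
    have hsub : Icc a b ⊆ Ω := hΩ.out ha hb
    obtain ⟨ξ, hξ, h⟩ := exists_hasDerivAt_eq_slope f f' hab
      (fun z hz => (hf z (hsub hz)).continuousWithinAt.mono hsub)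
      (fun z hz => (hf z (hsub (Ioo_subset_Icc_self hz))).hasDerivAt
        (mem_of_superset (Icc_mem_nhds hz.1 hz.2) hsub))
    refine ⟨ξ, hξ, ?_⟩
    rw [h, mul_div_cancel₀ _ (sub_pos.2 hab).ne']
  rcases lt_trichotomy x y with h | h | h
  · obtain ⟨ξ, hξ, e⟩ := key x hx y hy h
    refine ⟨ξ, hΩ.out hx hy (Ioo_subset_Icc_self hξ), ?_, e⟩
    rw [abs_of_pos (sub_pos.2 hξ.1), abs_of_pos (sub_pos.2 h)]
    linarith [hξ.2]
  · subst h
    exact ⟨x, hx, by simp⟩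
  · obtain ⟨ξ, hξ, e⟩ := key y hy x hx h
    refine ⟨ξ, hΩ.out hy hx (Ioo_subset_Icc_self hξ), ?_, by linarith⟩
    rw [abs_of_neg (sub_neg.2 hξ.2), abs_of_neg (sub_neg.2 h)]
    linarith [hξ.1]

/-- The second difference of a kernel is a value of its mixed derivative. -/
lemma exists_second_difference_eq {Ω : Set ℝ} (hΩ : Ω.OrdConnected) {k k₁ k₁₂ : ℝ → ℝ → ℝ}
    (h₁ : ∀ x ∈ Ω, ∀ y ∈ Ω, HasDerivWithinAt (fun x => k x y) (k₁ x y) Ω x)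
    (h₁₂ : ∀ x ∈ Ω, ∀ y ∈ Ω, HasDerivWithinAt (fun y => k₁ x y) (k₁₂ x y) Ω y)
    {x y z : ℝ} (hx : x ∈ Ω) (hy : y ∈ Ω) (hz : z ∈ Ω) :
    ∃ ξ ∈ Ω, ∃ η ∈ Ω, |ξ - x| ≤ |y - x| ∧ |η - x| ≤ |z - x| ∧
      k y z - k y x - k x z + k x x = (y - x) * (z - x) * k₁₂ ξ η := by
  obtain ⟨ξ, hξ, hξx, e₁⟩ := exists_sub_eq_mul_of_hasDerivWithinAt hΩ
    (f := fun t => k t z - k t x) (f' := fun t => k₁ t z - k₁ t x)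
    (fun t ht => (h₁ t ht z hz).sub (h₁ t ht x hx)) hx hy
  obtain ⟨η, hη, hηx, e₂⟩ := exists_sub_eq_mul_of_hasDerivWithinAt hΩ
    (f := fun t => k₁ ξ t) (f' := fun t => k₁₂ ξ t) (fun t ht => h₁₂ ξ hξ t ht) hx hz
  refine ⟨ξ, hξ, η, hη, hξx, hηx, ?_⟩
  rw [e₂] at e₁
  linarith

/-- A feature map of a kernel with continuous mixed derivative is differentiable. -/
lemma exists_hasDerivWithinAt_featureMap {H : Type u} [NormedAddCommGroup H]
    [InnerProductSpace ℝ H] [CompleteSpace H] {Ω : Set ℝ} (hΩ : Ω.OrdConnected)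
    (hne : (interior Ω).Nonempty) {k k₁ k₁₂ : ℝ → ℝ → ℝ} {Φ : ℝ → H}
    (hΦ : ∀ x ∈ Ω, ∀ y ∈ Ω, inner ℝ (Φ x) (Φ y) = k x y)
    (h₁ : ∀ x ∈ Ω, ∀ y ∈ Ω, HasDerivWithinAt (fun x => k x y) (k₁ x y) Ω x)
    (h₁₂ : ∀ x ∈ Ω, ∀ y ∈ Ω, HasDerivWithinAt (fun y => k₁ x y) (k₁₂ x y) Ω y)
    (hc : ContinuousOn (fun z : ℝ × ℝ => k₁₂ z.1 z.2) (Ω ×ˢ Ω)) :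
    ∃ Ψ : ℝ → H, (∀ x ∈ Ω, HasDerivWithinAt Φ (Ψ x) Ω x) ∧
      ∀ x ∈ Ω, ∀ y ∈ Ω, inner ℝ (Ψ x) (Ψ y) = k₁₂ x y := by
  have hud : UniqueDiffOn ℝ Ω := uniqueDiffOn_convex hΩ.convex hne
  have hex : ∀ x ∈ Ω, ∃ v : H, HasDerivWithinAt Φ v Ω x := by
    intro x hx
    have hinner : ∀ y ∈ Ω \ {x}, ∀ z ∈ Ω \ {x}, ∃ ξ ∈ Ω, ∃ η ∈ Ω, |ξ - x| ≤ |y - x| ∧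
        |η - x| ≤ |z - x| ∧ inner ℝ (slope Φ x y) (slope Φ x z) = k₁₂ ξ η := by
      intro y hy z hz
      obtain ⟨ξ, hξ, η, hη, a, b, e⟩ :=
        exists_second_difference_eq hΩ h₁ h₁₂ hx hy.1 hz.1
      refine ⟨ξ, hξ, η, hη, a, b, ?_⟩
      have hy0 : y - x ≠ 0 := sub_ne_zero.2 hy.2
      have hz0 : z - x ≠ 0 := sub_ne_zero.2 hz.2
      simp only [slope, vsub_eq_sub, inner_smul_left, inner_smul_right, inner_sub_left,
        inner_sub_right, hΦ y hy.1 z hz.1, hΦ y hy.1 x hx, hΦ x hx z hz.1, hΦ x hx x hx]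
      have e' : k y z - k x z - (k y x - k x x) = (y - x) * (z - x) * k₁₂ ξ η := by linarith
      simp only [starRingEnd_apply, star_trivial]
      rw [← mul_sub, e']
      field_simp
    have hnb : (𝓝[Ω \ {x}] x).NeBot := by
      have := (hud x hx).accPt
      rwa [accPt_principal_iff_nhdsWithin] at this
    have hcau : Cauchy (map (slope Φ x) (𝓝[Ω \ {x}] x)) := by
      rw [Metric.cauchy_iff]
      refine ⟨hnb.map _, fun ε hε => ?_⟩
      -- The squared distance of two slopes is `⟪a, a⟫ - 2⟪a, b⟫ + ⟪b, b⟫`, whose terms all approach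
      -- multiples of `k₁₂ x x` that cancel. The weights 1, 2, 1 account for the tolerance `ε ^ 2 /
      -- 4`.
      obtain ⟨δ, hδ, hδ'⟩ := Metric.continuousOn_iff.1 hc (x, x) ⟨hx, hx⟩ (ε ^ 2 / 4)
        (by positivity)
      have hnear : ∀ y ∈ (Ω \ {x}) ∩ Metric.ball x δ, ∀ z ∈ (Ω \ {x}) ∩ Metric.ball x δ,
          |inner ℝ (slope Φ x y) (slope Φ x z) - k₁₂ x x| < ε ^ 2 / 4 := by
        rintro y ⟨hy, hyδ⟩ z ⟨hz, hzδ⟩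
        obtain ⟨ξ, hξ, η, hη, a, b, e⟩ := hinner y hy z hz
        rw [e]
        have := hδ' (ξ, η) ⟨hξ, hη⟩ (by
          rw [Prod.dist_eq, max_lt_iff]
          simp only [Metric.mem_ball, Real.dist_eq] at hyδ hzδ ⊢
          exact ⟨a.trans_lt hyδ, b.trans_lt hzδ⟩)
        simpa [Real.dist_eq] using this
      refine ⟨slope Φ x '' ((Ω \ {x}) ∩ Metric.ball x δ), image_mem_map
        (inter_mem self_mem_nhdsWithin (mem_nhdsWithin_of_mem_nhds (Metric.ball_mem_nhds x hδ))),
        ?_⟩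
      rintro _ ⟨y, hy, rfl⟩ _ ⟨z, hz, rfl⟩
      have hsq : ‖slope Φ x y - slope Φ x z‖ ^ 2 < ε ^ 2 := by
        rw [norm_sub_sq_real, ← real_inner_self_eq_norm_sq, ← real_inner_self_eq_norm_sq]
        have a₁ := abs_lt.1 (hnear y hy y hy)
        have a₂ := abs_lt.1 (hnear y hy z hz)
        have a₃ := abs_lt.1 (hnear z hz z hz)
        linarith [a₁.2, a₂.1, a₃.2]
      rw [dist_eq_norm]
      exact lt_of_pow_lt_pow_left₀ 2 hε.le hsq
    obtain ⟨v, hv⟩ := CompleteSpace.complete hcau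
    exact ⟨v, hasDerivWithinAt_iff_tendsto_slope.2 hv⟩
  choose! Ψ hΨ using hex
  refine ⟨Ψ, hΨ, fun x hx y hy => ?_⟩
  have e₁ : ∀ t ∈ Ω, inner ℝ (Ψ x) (Φ t) = k₁ x t := by
    intro t ht
    have d : HasDerivWithinAt (fun s => inner ℝ (Φ s) (Φ t)) (inner ℝ (Ψ x) (Φ t)) Ω x := by
      simpa using (hΨ x hx).inner ℝ (hasDerivWithinAt_const x Ω (Φ t))
    have d' : HasDerivWithinAt (fun s => inner ℝ (Φ s) (Φ t)) (k₁ x t) Ω x :=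
      (h₁ x hx t ht).congr (fun s hs => hΦ s hs t ht) (hΦ x hx t ht)
    exact (hud x hx).eq_deriv _ d d'
  have d : HasDerivWithinAt (fun s => inner ℝ (Ψ x) (Φ s)) (inner ℝ (Ψ x) (Ψ y)) Ω y := by
    simpa using (hasDerivWithinAt_const y Ω (Ψ x)).inner ℝ (hΨ y hy)
  have d' : HasDerivWithinAt (fun s => inner ℝ (Ψ x) (Φ s)) (k₁₂ x y) Ω y :=
    (h₁₂ x hx y hy).congr (fun s hs => e₁ s hs) (e₁ y hy)
  exact (hud y hy).eq_deriv _ d d'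

/-! ### Chains of derivatives: Rolle's theorem and descent. -/

/-- Along a chain of derivatives within `Ω`, iterated derivatives are the members of the chain. -/
lemma iteratedDerivWithin_eq_of_chain {Ω : Set ℝ} (hud : UniqueDiffOn ℝ Ω) {q : ℕ}
    {g : ℕ → ℝ → ℝ} (hg : ∀ j < q, ∀ x ∈ Ω, HasDerivWithinAt (g j) (g (j + 1) x) Ω x) :
    ∀ j ≤ q, ∀ x ∈ Ω, iteratedDerivWithin j (g 0) Ω x = g j x := by
  intro j
  induction j with
  | zero => intro _ x _; simp
  | succ j ih =>
    intro hj x hx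
    rw [iteratedDerivWithin_succ]
    have := ih (by omega)
    rw [derivWithin_congr this (this x hx)]
    exact (hg j (by omega) x hx).derivWithin (hud x hx)

/-- The spare derivative `p < q` makes the `p`-th member of the chain differentiable, hence
continuous. -/
lemma contDiffOn_of_chain {Ω : Set ℝ} (hud : UniqueDiffOn ℝ Ω) {p q : ℕ} (hpq : p < q)
    {g : ℕ → ℝ → ℝ} (hg : ∀ j < q, ∀ x ∈ Ω, HasDerivWithinAt (g j) (g (j + 1) x) Ω x) :
    ContDiffOn ℝ p (g 0) Ω := by
  have := contDiffOn_of_differentiableOn_deriv (𝕜 := ℝ) (f := g 0) (s := Ω) (n := (p : ℕ∞))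
    (fun m hm => by
      have hm' : m ≤ p := by exact_mod_cast hm
      exact DifferentiableOn.congr
        (fun x hx => (hg m (by omega) x hx).differentiableWithinAt)
        (iteratedDerivWithin_eq_of_chain hud hg m (by omega)))
  exact_mod_cast this

/-- Iterated Rolle theorem for a chain of derivatives. -/
lemma exists_zero_of_chain {Ω : Set ℝ} {α β : ℝ} (hsub : Icc α β ⊆ Ω) (n : ℕ) :
    ∀ (g : ℕ → ℝ → ℝ) (z : ℕ → ℝ),
      (∀ j < n, ∀ x ∈ Ω, HasDerivWithinAt (g j) (g (j + 1) x) Ω x) →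
      (∀ i < n, z i < z (i + 1)) → (∀ i ≤ n, z i ∈ Icc α β ∧ g 0 (z i) = 0) →
      ∀ j ≤ n, ∃ ξ ∈ Icc α β, g j ξ = 0 := by
  induction n with
  | zero =>
    intro g z _ _ hz j hj
    obtain rfl : j = 0 := by omega
    exact ⟨z 0, hz 0 le_rfl⟩
  | succ n ih =>
    intro g z hg hlt hz j hj
    rcases j with _ | j
    · exact ⟨z 0, hz 0 (by omega)⟩
    have hrolle : ∀ i ≤ n, ∃ ξ, z i < ξ ∧ ξ < z (i + 1) ∧ g 1 ξ = 0 := by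
      intro i hi
      have hs : Icc (z i) (z (i + 1)) ⊆ Ω :=
        (Icc_subset_Icc (hz i (by omega)).1.1 (hz (i + 1) (by omega)).1.2).trans hsub
      obtain ⟨ξ, hξ, e⟩ := exists_hasDerivAt_eq_zero (f := g 0) (f' := g 1) (hlt i (by omega))
        (fun x hx => (hg 0 (by omega) x (hs hx)).continuousWithinAt.mono hs)
        (by rw [(hz i (by omega)).2, (hz (i + 1) (by omega)).2])
        (fun x hx => (hg 0 (by omega) x (hs (Ioo_subset_Icc_self hx))).hasDerivAt
          (mem_of_superset (Icc_mem_nhds hx.1 hx.2) hs))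
      exact ⟨ξ, hξ.1, hξ.2, e⟩
    choose! w hw₁ hw₂ hw₃ using hrolle
    refine ih (fun i => g (i + 1)) w (fun j hj => hg (j + 1) (by omega))
      (fun i hi => (hw₂ i (by omega)).trans (hw₁ (i + 1) (by omega)))
      (fun i hi => ⟨⟨?_, ?_⟩, hw₃ i hi⟩) j (by omega)
    · exact (hz i (by omega)).1.1.trans (hw₁ i hi).le
    · exact (hw₂ i hi).le.trans (hz (i + 1) (by omega)).1.2

/-- Bound for the lower members of a chain of derivatives which all have a zero in an interval. -/
lemma abs_chain_le {Ω : Set ℝ} {α β r M : ℝ} (hsub : Icc α β ⊆ Ω) (hr : β - α ≤ r) {n : ℕ}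
    {g : ℕ → ℝ → ℝ}
    (hg : ∀ j < n, ∀ x ∈ Ω, HasDerivWithinAt (g j) (g (j + 1) x) Ω x)
    (hz : ∀ j < n, ∃ ξ ∈ Icc α β, g j ξ = 0) (hM : ∀ x ∈ Icc α β, |g n x| ≤ M) :
    ∀ i ≤ n, ∀ x ∈ Icc α β, |g (n - i) x| ≤ r ^ i * M := by
  intro i
  induction i with
  | zero => intro _ x hx; simpa using hM x hx
  | succ i ih =>
    intro hi x hx
    obtain ⟨ξ, hξ, e⟩ := hz (n - (i + 1)) (by omega)
    have e1 : n - (i + 1) + 1 = n - i := by omega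
    -- Measured from the zero `ξ` of the lower member, the mean value inequality costs one factor
    -- `r`.
    have h := (convex_Icc α β).norm_image_sub_le_of_norm_hasDerivWithin_le
      (f := g (n - (i + 1))) (f' := g (n - i)) (C := r ^ i * M)
      (fun y hy => by
        have := (hg (n - (i + 1)) (by omega) y (hsub hy)).mono hsub
        rwa [e1] at this)
      (fun y hy => ih (by omega) y hy) hξ hx
    rw [e, sub_zero, Real.norm_eq_abs, Real.norm_eq_abs] at h
    have h2 : |x - ξ| ≤ r := by
      rw [abs_le]; constructor <;> linarith [hx.1, hx.2, hξ.1, hξ.2]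
    have h3 : 0 ≤ r ^ i * M := (abs_nonneg _).trans (ih (by omega) x hx)
    calc _ ≤ _ := h
      _ ≤ r ^ i * M * r := by gcongr
      _ = _ := by ring

/-! ### Regularity in each variable separately. -/

/-- Partial derivatives of order at most `m` in the first and `n` in the second variable exist
within `Ω`, in any order, and are bounded and continuous on `Ω × Ω`. -/
def MixedReg (Ω : Set ℝ) (m n : ℕ) (k : ℝ → ℝ → ℝ) : Prop :=
  (∃ M : ℝ, ∀ x ∈ Ω, ∀ y ∈ Ω, |k x y| ≤ M) ∧
  ContinuousOn (fun z : ℝ × ℝ => k z.1 z.2) (Ω ×ˢ Ω) ∧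
  (∀ m', m = m' + 1 → ∃ k₁ : ℝ → ℝ → ℝ,
    (∀ x ∈ Ω, ∀ y ∈ Ω, HasDerivWithinAt (fun x => k x y) (k₁ x y) Ω x) ∧ MixedReg Ω m' n k₁) ∧
  (∀ n', n = n' + 1 → ∃ k₂ : ℝ → ℝ → ℝ,
    (∀ x ∈ Ω, ∀ y ∈ Ω, HasDerivWithinAt (fun y => k x y) (k₂ x y) Ω y) ∧ MixedReg Ω m n' k₂)
termination_by m + n

namespace MixedReg

variable {Ω : Set ℝ}

lemma bounded {m n : ℕ} {k : ℝ → ℝ → ℝ} (h : MixedReg Ω m n k) :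
    ∃ M : ℝ, ∀ x ∈ Ω, ∀ y ∈ Ω, |k x y| ≤ M := by
  rw [MixedReg] at h; exact h.1

lemma continuousOn {m n : ℕ} {k : ℝ → ℝ → ℝ} (h : MixedReg Ω m n k) :
    ContinuousOn (fun z : ℝ × ℝ => k z.1 z.2) (Ω ×ˢ Ω) := by
  rw [MixedReg] at h; exact h.2.1

lemma exists_left {m n : ℕ} {k : ℝ → ℝ → ℝ} (h : MixedReg Ω (m + 1) n k) :
    ∃ k₁ : ℝ → ℝ → ℝ, (∀ x ∈ Ω, ∀ y ∈ Ω, HasDerivWithinAt (fun x => k x y) (k₁ x y) Ω x) ∧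
      MixedReg Ω m n k₁ := by
  rw [MixedReg] at h; exact h.2.2.1 m rfl

lemma exists_right {m n : ℕ} {k : ℝ → ℝ → ℝ} (h : MixedReg Ω m (n + 1) k) :
    ∃ k₂ : ℝ → ℝ → ℝ, (∀ x ∈ Ω, ∀ y ∈ Ω, HasDerivWithinAt (fun y => k x y) (k₂ x y) Ω y) ∧
      MixedReg Ω m n k₂ := by
  rw [MixedReg] at h; exact h.2.2.2 n rfl

/-- Induction on the orders of the two variables. -/
lemma order_induction {P : ℕ → ℕ → Prop}
    (h : ∀ m n, (∀ m', m = m' + 1 → P m' n) → (∀ n', n = n' + 1 → P m n') → P m n) (m n : ℕ) :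
    P m n := by
  suffices ∀ t m n, m + n = t → P m n from this _ m n rfl
  intro t
  induction t with
  | zero => intro m n e; exact h m n (fun _ _ => by omega) (fun _ _ => by omega)
  | succ t ih => intro m n e; exact h m n (fun m' _ => ih m' n (by omega))
                  (fun n' _ => ih m n' (by omega))

lemma mono {m n : ℕ} : ∀ {m' n' : ℕ} {k : ℝ → ℝ → ℝ}, m ≤ m' → n ≤ n' →
    MixedReg Ω m' n' k → MixedReg Ω m n k := by
  induction m, n using order_induction with
  | h m n ihm ihn =>
    intro m' n' k hm hn h
    rw [MixedReg]
    refine ⟨h.bounded, h.continuousOn, ?_, ?_⟩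
    · rintro m₀ rfl
      obtain ⟨m₁, rfl⟩ : ∃ m₁, m' = m₁ + 1 := ⟨m' - 1, by omega⟩
      obtain ⟨k₁, d, r⟩ := h.exists_left
      exact ⟨k₁, d, ihm m₀ rfl (by omega) hn r⟩
    · rintro n₀ rfl
      obtain ⟨n₁, rfl⟩ : ∃ n₁, n' = n₁ + 1 := ⟨n' - 1, by omega⟩
      obtain ⟨k₂, d, r⟩ := h.exists_right
      exact ⟨k₂, d, ihn n₀ rfl hm (by omega) r⟩

lemma congr {m n : ℕ} {k l : ℝ → ℝ → ℝ} (h : MixedReg Ω m n k)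
    (e : ∀ x ∈ Ω, ∀ y ∈ Ω, l x y = k x y) : MixedReg Ω m n l := by
  rw [MixedReg] at h ⊢
  obtain ⟨⟨M, hM⟩, hc, hl, hr⟩ := h
  refine ⟨⟨M, fun x hx y hy => by rw [e x hx y hy]; exact hM x hx y hy⟩,
    hc.congr fun z hz => e z.1 hz.1 z.2 hz.2, ?_, ?_⟩
  · intro m' hm
    obtain ⟨k₁, d, r⟩ := hl m' hm
    exact ⟨k₁, fun x hx y hy => (d x hx y hy).congr (fun t ht => e t ht y hy) (e x hx y hy), r⟩
  · intro n' hn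
    obtain ⟨k₂, d, r⟩ := hr n' hn
    exact ⟨k₂, fun x hx y hy => (d x hx y hy).congr (fun t ht => e x hx t ht) (e x hx y hy), r⟩

lemma const (c : ℝ) {m n : ℕ} : MixedReg Ω m n (fun _ _ => c) := by
  induction m, n using order_induction generalizing c with
  | h m n ihm ihn =>
    rw [MixedReg]
    exact ⟨⟨|c|, fun _ _ _ _ => le_rfl⟩, continuousOn_const,
      fun m' e => ⟨fun _ _ => 0, fun _ _ _ _ => hasDerivWithinAt_const .., ihm m' e 0⟩,
      fun n' e => ⟨fun _ _ => 0, fun _ _ _ _ => hasDerivWithinAt_const .., ihn n' e 0⟩⟩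

lemma add {m n : ℕ} : ∀ {k l : ℝ → ℝ → ℝ}, MixedReg Ω m n k → MixedReg Ω m n l →
    MixedReg Ω m n (fun x y => k x y + l x y) := by
  induction m, n using order_induction with
  | h m n ihm ihn =>
    intro k l hk hl
    obtain ⟨M, hM⟩ := hk.bounded
    obtain ⟨N, hN⟩ := hl.bounded
    rw [MixedReg]
    refine ⟨⟨M + N, fun x hx y hy => (abs_add_le _ _).trans (add_le_add (hM x hx y hy)
      (hN x hx y hy))⟩, hk.continuousOn.add hl.continuousOn, ?_, ?_⟩
    · rintro m₀ rfl
      obtain ⟨k₁, dk, rk⟩ := hk.exists_left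
      obtain ⟨l₁, dl, rl⟩ := hl.exists_left
      exact ⟨_, fun x hx y hy => (dk x hx y hy).add (dl x hx y hy), ihm m₀ rfl rk rl⟩
    · rintro n₀ rfl
      obtain ⟨k₁, dk, rk⟩ := hk.exists_right
      obtain ⟨l₁, dl, rl⟩ := hl.exists_right
      exact ⟨_, fun x hx y hy => (dk x hx y hy).add (dl x hx y hy), ihn n₀ rfl rk rl⟩

lemma mul {m n : ℕ} : ∀ {k l : ℝ → ℝ → ℝ}, MixedReg Ω m n k → MixedReg Ω m n l →
    MixedReg Ω m n (fun x y => k x y * l x y) := by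
  induction m, n using order_induction with
  | h m n ihm ihn =>
    intro k l hk hl
    obtain ⟨M, hM⟩ := hk.bounded
    obtain ⟨N, hN⟩ := hl.bounded
    rw [MixedReg]
    refine ⟨⟨M * N, fun x hx y hy => ?_⟩, hk.continuousOn.mul hl.continuousOn, ?_, ?_⟩
    · rw [abs_mul]
      exact mul_le_mul (hM x hx y hy) (hN x hx y hy) (abs_nonneg _)
        ((abs_nonneg _).trans (hM x hx y hy))
    · rintro m₀ rfl
      obtain ⟨k₁, dk, rk⟩ := hk.exists_left
      obtain ⟨l₁, dl, rl⟩ := hl.exists_left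
      exact ⟨_, fun x hx y hy => (dk x hx y hy).mul (dl x hx y hy),
        -- The product rule differentiates one factor, so the other is first weakened to the lower
        -- order.
        (ihm m₀ rfl rk (hl.mono (by omega) le_rfl)).add
          (ihm m₀ rfl (hk.mono (by omega) le_rfl) rl)⟩
    · rintro n₀ rfl
      obtain ⟨k₁, dk, rk⟩ := hk.exists_right
      obtain ⟨l₁, dl, rl⟩ := hl.exists_right
      exact ⟨_, fun x hx y hy => (dk x hx y hy).mul (dl x hx y hy),
        (ihn n₀ rfl rk (hl.mono le_rfl (by omega))).add
          (ihn n₀ rfl (hk.mono le_rfl (by omega)) rl)⟩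

lemma sum {m n : ℕ} {ι : Type*} (s : Finset ι) {k : ι → ℝ → ℝ → ℝ}
    (h : ∀ i ∈ s, MixedReg Ω m n (k i)) : MixedReg Ω m n (fun x y => ∑ i ∈ s, k i x y) := by
  classical
  induction s using Finset.induction_on with
  | empty => simpa using const 0
  | insert a s ha ih =>
    refine ((h a (Finset.mem_insert_self a s)).add
      (ih fun i hi => h i (Finset.mem_insert_of_mem hi))).congr fun x _ y _ => ?_
    rw [Finset.sum_insert ha]

lemma const_mul (c : ℝ) {m n : ℕ} {k : ℝ → ℝ → ℝ} (h : MixedReg Ω m n k) :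
    MixedReg Ω m n (fun x y => c * k x y) :=
  (const c).mul h

lemma sub {m n : ℕ} {k l : ℝ → ℝ → ℝ} (hk : MixedReg Ω m n k) (hl : MixedReg Ω m n l) :
    MixedReg Ω m n (fun x y => k x y - l x y) :=
  (hk.add (hl.const_mul (-1))).congr fun x _ y _ => by ring

lemma exp {m n : ℕ} : ∀ {k : ℝ → ℝ → ℝ}, MixedReg Ω m n k →
    MixedReg Ω m n (fun x y => Real.exp (k x y)) := by
  induction m, n using order_induction with
  | h m n ihm ihn =>
    intro k hk
    obtain ⟨M, hM⟩ := hk.bounded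
    rw [MixedReg]
    refine ⟨⟨Real.exp M, fun x hx y hy => ?_⟩, hk.continuousOn.rexp, ?_, ?_⟩
    · rw [Real.abs_exp]
      exact Real.exp_le_exp.2 ((le_abs_self _).trans (hM x hx y hy))
    · rintro m₀ rfl
      obtain ⟨k₁, dk, rk⟩ := hk.exists_left
      exact ⟨_, fun x hx y hy => (dk x hx y hy).exp,
        (ihm m₀ rfl (hk.mono (by omega) le_rfl)).mul rk⟩
    · rintro n₀ rfl
      obtain ⟨k₁, dk, rk⟩ := hk.exists_right
      exact ⟨_, fun x hx y hy => (dk x hx y hy).exp,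
        (ihn n₀ rfl (hk.mono le_rfl (by omega))).mul rk⟩

lemma rpow {m n : ℕ} {c : ℝ} (hc : 0 < c) : ∀ {k : ℝ → ℝ → ℝ} (q : ℝ), MixedReg Ω m n k →
    (∀ x ∈ Ω, ∀ y ∈ Ω, c ≤ k x y) → MixedReg Ω m n (fun x y => k x y ^ q) := by
  induction m, n using order_induction with
  | h m n ihm ihn =>
    intro k q hk hck
    obtain ⟨M, hM⟩ := hk.bounded
    have hne : ∀ x ∈ Ω, ∀ y ∈ Ω, k x y ≠ 0 := fun x hx y hy => (hc.trans_le (hck x hx y hy)).ne'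
    rw [MixedReg]
    -- The sum covers both signs of `q`: `M ^ q` bounds increasing powers and `c ^ q` decreasing
    -- ones.
    refine ⟨⟨c ^ q + M ^ q, fun x hx y hy => ?_⟩,
      hk.continuousOn.rpow_const fun z hz => Or.inl (hne z.1 hz.1 z.2 hz.2), ?_, ?_⟩
    · have h1 := hck x hx y hy
      have h2 := (le_abs_self _).trans (hM x hx y hy)
      have h0 : 0 < k x y := hc.trans_le h1
      rw [abs_of_nonneg (Real.rpow_nonneg h0.le q)]
      rcases le_total 0 q with hq | hq
      · exact (Real.rpow_le_rpow h0.le h2 hq).trans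
          (le_add_of_nonneg_left (Real.rpow_nonneg hc.le q))
      · exact (Real.rpow_le_rpow_of_nonpos hc h1 hq).trans
          (le_add_of_nonneg_right (Real.rpow_nonneg (h0.le.trans h2) q))
    · rintro m₀ rfl
      obtain ⟨k₁, dk, rk⟩ := hk.exists_left
      exact ⟨_, fun x hx y hy => (dk x hx y hy).rpow_const (Or.inl (hne x hx y hy)),
        (rk.mul (const q)).mul (ihm m₀ rfl (q - 1) (hk.mono (by omega) le_rfl) hck)⟩
    · rintro n₀ rfl
      obtain ⟨k₁, dk, rk⟩ := hk.exists_right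
      exact ⟨_, fun x hx y hy => (dk x hx y hy).rpow_const (Or.inl (hne x hx y hy)),
        (rk.mul (const q)).mul (ihn n₀ rfl (q - 1) (hk.mono le_rfl (by omega)) hck)⟩

/-- A bounded chain of derivatives, as a function of the first variable. -/
lemma of_chain_left {m n : ℕ} : ∀ {g : ℕ → ℝ → ℝ},
    (∀ j < m, ∀ x ∈ Ω, HasDerivWithinAt (g j) (g (j + 1) x) Ω x) →
    (∀ j ≤ m, ContinuousOn (g j) Ω) → (∀ j ≤ m, ∃ M, ∀ x ∈ Ω, |g j x| ≤ M) →
    MixedReg Ω m n (fun x _ => g 0 x) := by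
  induction m, n using order_induction with
  | h m n ihm ihn =>
    intro g hd hc hb
    obtain ⟨M, hM⟩ := hb 0 (by omega)
    rw [MixedReg]
    refine ⟨⟨M, fun x hx _ _ => hM x hx⟩,
      (hc 0 (by omega)).comp continuousOn_fst fun z hz => hz.1, ?_, ?_⟩
    · rintro m₀ rfl
      exact ⟨fun x _ => g 1 x, fun x hx y hy => hd 0 (by omega) x hx,
        ihm m₀ rfl (g := fun j => g (j + 1)) (fun j hj => hd (j + 1) (by omega))
          (fun j hj => hc (j + 1) (by omega)) (fun j hj => hb (j + 1) (by omega))⟩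
    · rintro n₀ rfl
      exact ⟨fun _ _ => 0, fun x hx y hy => hasDerivWithinAt_const .., const 0⟩

lemma swap {m n : ℕ} : ∀ {k : ℝ → ℝ → ℝ}, MixedReg Ω m n k →
    MixedReg Ω n m (fun x y => k y x) := by
  induction m, n using order_induction with
  | h m n ihm ihn =>
    intro k hk
    obtain ⟨M, hM⟩ := hk.bounded
    rw [MixedReg]
    refine ⟨⟨M, fun x hx y hy => hM y hy x hx⟩,
      hk.continuousOn.comp (f := Prod.swap) continuous_swap.continuousOn
        (fun z hz => ⟨hz.2, hz.1⟩), ?_, ?_⟩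
    · rintro n₀ rfl
      obtain ⟨k₂, d, r⟩ := hk.exists_right
      exact ⟨fun x y => k₂ y x, fun x hx y hy => d y hy x hx, ihn n₀ rfl r⟩
    · rintro m₀ rfl
      obtain ⟨k₁, d, r⟩ := hk.exists_left
      exact ⟨fun x y => k₁ y x, fun x hx y hy => d y hy x hx, ihm m₀ rfl r⟩

lemma of_isCm_left (hud : UniqueDiffOn ℝ Ω) {m n : ℕ} {g : ℝ → ℝ} (hg : IsCm Ω m g) :
    MixedReg Ω m n (fun x _ => g x) := by
  have := of_chain_left (Ω := Ω) (m := m) (n := n) (g := fun j => iteratedDerivWithin j g Ω)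
    (fun j hj x hx => by
      have hd := hg.1.differentiableOn_iteratedDerivWithin (m := j) (by exact_mod_cast hj) hud
      simp only [iteratedDerivWithin_succ]
      exact (hd x hx).hasDerivWithinAt)
    (fun j hj => hg.1.continuousOn_iteratedDerivWithin (by exact_mod_cast hj) hud)
    (fun j hj => by
      obtain ⟨M, hM⟩ := hg.2 j hj
      exact ⟨M, fun x hx => hM ⟨x, hx, rfl⟩⟩)
  simpa using this

lemma of_isCm_right (hud : UniqueDiffOn ℝ Ω) {m n : ℕ} {g : ℝ → ℝ} (hg : IsCm Ω n g) :
    MixedReg Ω m n (fun _ y => g y) :=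
  (of_isCm_left hud hg).swap

lemma fst (hΩ : Bornology.IsBounded Ω) {m n : ℕ} : MixedReg Ω m n (fun x _ => x) := by
  obtain ⟨M, hM⟩ := hΩ.exists_norm_le
  refine of_chain_left (g := fun j x => if j = 0 then x else if j = 1 then 1 else 0)
    (fun j _ x _ => ?_) (fun j _ => ?_) (fun j _ => ?_)
  · rcases j with _ | _ | j
    · exact hasDerivWithinAt_id x Ω
    · simpa using hasDerivWithinAt_const x Ω (1 : ℝ)
    · simpa using hasDerivWithinAt_const x Ω (0 : ℝ)
  · rcases j with _ | _ | j <;> simp <;> fun_prop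
  · rcases j with _ | _ | j
    · exact ⟨M, fun x hx => by simpa using hM x hx⟩
    · exact ⟨1, fun x hx => by simp⟩
    · exact ⟨0, fun x hx => by simp⟩

lemma snd (hΩ : Bornology.IsBounded Ω) {m n : ℕ} : MixedReg Ω m n (fun _ y => y) :=
  (fst hΩ).swap

lemma iteratedDerivWithin_right (hud : UniqueDiffOn ℝ Ω) {k : ℝ → ℝ → ℝ} (j : ℕ) {m n : ℕ}
    (hk : MixedReg Ω m (n + j) k) :
    MixedReg Ω m n (fun x y => iteratedDerivWithin j (fun y => k x y) Ω y) := by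
  induction j generalizing n with
  | zero => simpa using hk
  | succ j ih =>
    obtain ⟨k₂, d, r⟩ := (ih (n := n + 1) (by rwa [add_assoc, add_comm 1 j])).exists_right
    refine r.congr fun x hx y hy => ?_
    rw [iteratedDerivWithin_succ]
    exact (d x hx y hy).derivWithin (hud y hy)

lemma mixedDeriv (hud : UniqueDiffOn ℝ Ω) {k : ℝ → ℝ → ℝ} (i j : ℕ) {m n : ℕ}
    (hk : MixedReg Ω (m + i) (n + j) k) : MixedReg Ω m n (mixedDeriv Ω i j k) :=
  (iteratedDerivWithin_right hud i (iteratedDerivWithin_right hud j hk).swap).swap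

lemma bddAbove_mixedDeriv (hud : UniqueDiffOn ℝ Ω) {k : ℝ → ℝ → ℝ} {i j m n : ℕ}
    (hi : i ≤ m) (hj : j ≤ n) (hk : MixedReg Ω m n k) :
    BddAbove {x : ℝ | ∃ u ∈ Ω, ∃ v ∈ Ω, x = |_root_.mixedDeriv Ω i j k u v|} := by
  obtain ⟨M, hM⟩ := (mixedDeriv hud i j (m := m - i) (n := n - j)
    (by rwa [Nat.sub_add_cancel hi, Nat.sub_add_cancel hj])).bounded
  refine ⟨M, ?_⟩
  rintro _ ⟨u, hu, v, hv, rfl⟩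
  exact hM u hu v hv

end MixedReg

/-! ### Positive definiteness through Gaussian densities. -/

/-- Unnormalised Gaussian density with mean `t` and squared width `A`. -/
noncomputable def gaussBump (A t x : ℝ) : ℝ := Real.exp (-(x - t) ^ 2 / A)

lemma continuous_gaussBump (A t : ℝ) : Continuous (gaussBump A t) := by
  unfold gaussBump; fun_prop

/-- Completing the square in a product of two Gaussian densities. -/
lemma gaussBump_mul {A B : ℝ} (hA : 0 < A) (hB : 0 < B) (t r x : ℝ) :
    gaussBump A t x * gaussBump B r x =
      Real.exp (-(t - r) ^ 2 / (A + B)) *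
        Real.exp (-((A + B) / (A * B)) * (x - (B * t + A * r) / (A + B)) ^ 2) := by
  unfold gaussBump
  rw [← Real.exp_add, ← Real.exp_add]
  congr 1
  field_simp
  ring

lemma integrable_gaussBump_mul {A B : ℝ} (hA : 0 < A) (hB : 0 < B) (t r : ℝ) :
    MeasureTheory.Integrable fun x => gaussBump A t x * gaussBump B r x := by
  simp_rw [gaussBump_mul hA hB]
  exact ((integrable_exp_neg_mul_sq (b := (A + B) / (A * B)) (by positivity)).comp_sub_right
    _).const_mul _

lemma integral_gaussBump_mul {A B : ℝ} (hA : 0 < A) (hB : 0 < B) (t r : ℝ) :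
    ∫ x, gaussBump A t x * gaussBump B r x =
      Real.exp (-(t - r) ^ 2 / (A + B)) * Real.sqrt (Real.pi / ((A + B) / (A * B))) := by
  simp_rw [gaussBump_mul hA hB]
  rw [MeasureTheory.integral_const_mul,
    MeasureTheory.integral_sub_right_eq_self
      (fun x => Real.exp (-((A + B) / (A * B)) * x ^ 2)), integral_gaussian]

/-- A Gaussian density is dominated at infinity by one with lexicographically larger
width and mean. -/
lemma tendsto_gaussBump_div {A B t r : ℝ} (hA : 0 < A) (hB : 0 < B)
    (h : A < B ∨ A = B ∧ t < r) :
    Tendsto (fun x => gaussBump A t x / gaussBump B r x) atTop (𝓝 0) := by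
  have e : ∀ x, gaussBump A t x / gaussBump B r x =
      Real.exp (((1 / B - 1 / A) * x + (2 * t / A - 2 * r / B)) * x +
        (r ^ 2 / B - t ^ 2 / A)) := by
    intro x
    unfold gaussBump
    rw [← Real.exp_sub]
    congr 1
    field_simp
    ring
  simp_rw [e]
  refine Real.tendsto_exp_atBot.comp (tendsto_atBot_add_const_right _ _ ?_)
  -- The exponent is quadratic with leading coefficient `1 / B - 1 / A`; when the widths agree it is
  -- linear with slope `2 (t - r) / A`.
  rcases h with h | ⟨rfl, h⟩
  · have h1 : 1 / B - 1 / A < 0 := sub_neg.2 (one_div_lt_one_div_of_lt hA h)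
    exact (tendsto_atBot_add_const_right _ _
      ((tendsto_const_mul_atBot_of_neg h1).2 tendsto_id)).atBot_mul_atTop₀ tendsto_id
  · have h1 : 2 * t / A - 2 * r / A < 0 := sub_neg.2 (by gcongr)
    simp only [sub_self, zero_mul, zero_add]
    exact (tendsto_const_mul_atBot_of_neg h1).2 tendsto_id

/-- Gaussian densities with distinct parameters are linearly independent. -/
lemma gaussBump_linearIndependent {n : ℕ} {A t c : Fin n → ℝ} (hA : ∀ i, 0 < A i)
    (hinj : Function.Injective fun i => (A i, t i))
    (h0 : ∀ x, ∑ i, c i * gaussBump (A i) (t i) x = 0) : c = 0 := by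
  by_contra hc
  obtain ⟨i₀, hi₀⟩ := Function.ne_iff.1 hc
  -- After division by the lexicographically largest density with nonzero coefficient, only that
  -- coefficient survives as `x → ∞`.
  obtain ⟨m, hm, hmax⟩ := (Finset.univ.filter fun i => c i ≠ 0).exists_max_image
    (fun i => toLex (A i, t i)) ⟨i₀, by simpa using hi₀⟩
  have hcm : c m ≠ 0 := by simpa using hm
  have hlim : Tendsto (fun x => ∑ i, c i * (gaussBump (A i) (t i) x / gaussBump (A m) (t m) x))
      atTop (𝓝 (∑ i, if i = m then c m else 0)) := by
    refine tendsto_finsetSum _ fun i _ => ?_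
    by_cases him : i = m
    · subst him
      have : ∀ x, gaussBump (A i) (t i) x / gaussBump (A i) (t i) x = 1 :=
        fun x => div_self (Real.exp_pos _).ne'
      simp [this]
    · rw [if_neg him]
      by_cases hci : c i = 0
      · simp [hci]
      have hle := hmax i (by simpa using hci)
      have hlt : toLex (A i, t i) < toLex (A m, t m) :=
        lt_of_le_of_ne hle fun e => him (hinj (toLex.injective e))
      rw [Prod.Lex.toLex_lt_toLex] at hlt
      simpa using (tendsto_gaussBump_div (hA i) (hA m) hlt).const_mul (c i)
  have hz : ∀ x, ∑ i, c i * (gaussBump (A i) (t i) x / gaussBump (A m) (t m) x) = 0 := by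
    intro x
    simp_rw [← mul_div_assoc, ← Finset.sum_div, h0 x, zero_div]
  simp_rw [hz] at hlim
  have := tendsto_nhds_unique hlim tendsto_const_nhds
  simp at this
  exact hcm this

/-- Strict positive definiteness of the Gram matrix of Gaussian densities in `L²`. -/
lemma sum_gaussBump_gram_pos {n : ℕ} {A t c : Fin n → ℝ} (hA : ∀ i, 0 < A i)
    (hinj : Function.Injective fun i => (A i, t i)) (hc : c ≠ 0) :
    0 < ∑ i, ∑ j, c i * c j * ∫ x, gaussBump (A i) (t i) x * gaussBump (A j) (t j) x := by
  set F : ℝ → ℝ := fun x => ∑ i, c i * gaussBump (A i) (t i) x with hF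
  have hsq : ∀ x, F x ^ 2 =
      ∑ i, ∑ j, c i * c j * (gaussBump (A i) (t i) x * gaussBump (A j) (t j) x) := by
    intro x
    rw [sq, hF, Finset.sum_mul_sum]
    exact Finset.sum_congr rfl fun i _ => Finset.sum_congr rfl fun j _ => by ring
  have hint : ∀ i j, MeasureTheory.Integrable fun x =>
      c i * c j * (gaussBump (A i) (t i) x * gaussBump (A j) (t j) x) :=
    fun i j => (integrable_gaussBump_mul (hA i) (hA j) _ _).const_mul _
  have hI : ∑ i, ∑ j, c i * c j * ∫ x, gaussBump (A i) (t i) x * gaussBump (A j) (t j) x =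
      ∫ x, F x ^ 2 := by
    simp_rw [hsq]
    rw [MeasureTheory.integral_finsetSum _
      fun i _ => MeasureTheory.integrable_finsetSum _ fun j _ => hint i j]
    refine Finset.sum_congr rfl fun i _ => ?_
    rw [MeasureTheory.integral_finsetSum _ fun j _ => hint i j]
    simp_rw [MeasureTheory.integral_const_mul]
  have hFi : MeasureTheory.Integrable fun x => F x ^ 2 := by
    simp_rw [hsq]
    exact MeasureTheory.integrable_finsetSum _
      fun i _ => MeasureTheory.integrable_finsetSum _ fun j _ => hint i j
  have hFc : Continuous F :=
    continuous_finsetSum _ fun i _ => continuous_const.mul (continuous_gaussBump _ _)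
  obtain ⟨x₀, hx₀⟩ : ∃ x, F x ≠ 0 := by
    by_contra! h
    exact hc (gaussBump_linearIndependent hA hinj h)
  -- The quadratic form is `∫ F ^ 2` with `F` continuous and not identically zero, so its support is
  -- open and nonempty.
  rw [hI, MeasureTheory.integral_pos_iff_support_of_nonneg (fun x => sq_nonneg _) hFi]
  exact (hFc.pow 2).isOpen_support.measure_pos _ ⟨x₀, by simpa using hx₀⟩

/-- The nonvanishing weights `b` are absorbed into the coefficients of the quadratic form;
injectivity of `(A, t)` keeps the densities distinct. -/
lemma isPosDefKernel_of_gaussBump {Ω : Set ℝ} {k : ℝ → ℝ → ℝ} {κ : ℝ} {A t b : ℝ → ℝ}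
    (hκ : 0 < κ) (hA : ∀ u ∈ Ω, 0 < A u) (hb : ∀ u ∈ Ω, b u ≠ 0)
    (hinj : InjOn (fun u => (A u, t u)) Ω)
    (hk : ∀ u ∈ Ω, ∀ v ∈ Ω, k u v =
      κ * (b u * b v * ∫ x, gaussBump (A u) (t u) x * gaussBump (A v) (t v) x)) :
    IsPosDefKernel Ω k := by
  intro n u hu c hc
  have h := sum_gaussBump_gram_pos (A := fun i => A (u i)) (t := fun i => t (u i))
    (c := fun i => c i * b (u i)) (fun i => hA _ (u i).2)
    (fun i j e => hu (Subtype.ext (hinj (u i).2 (u j).2 e)))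
    (fun e => hc (funext fun i => (mul_eq_zero.1 (congrFun e i)).resolve_right (hb _ (u i).2)))
  have h' := mul_pos hκ h
  simp_rw [Finset.mul_sum] at h'
  refine h'.trans_eq (Finset.sum_congr rfl fun i _ => Finset.sum_congr rfl fun j _ => ?_)
  rw [hk _ (u i).2 _ (u j).2]
  ring

lemma isPosDefKernel_warp {Ω : Set ℝ} {s lam : ℝ} {w : ℝ → ℝ} (hs : 0 < s) (hl : 0 < lam)
    (hw : InjOn w Ω) : IsPosDefKernel Ω (warpKernel w (gaussianKernel s lam)) := by
  refine isPosDefKernel_of_gaussBump (A := fun _ => lam ^ 2) (t := w) (b := fun _ => 1)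
    (κ := s ^ 2 / Real.sqrt (Real.pi / ((lam ^ 2 + lam ^ 2) / (lam ^ 2 * lam ^ 2))))
    (by have := Real.pi_pos; positivity) (fun _ _ => by positivity) (fun _ _ => one_ne_zero)
    (fun u hu v hv e => hw hu hv (Prod.ext_iff.1 e).2) ?_
  intro u _ v _
  rw [integral_gaussBump_mul (by positivity) (by positivity)]
  have : Real.sqrt (Real.pi / ((lam ^ 2 + lam ^ 2) / (lam ^ 2 * lam ^ 2))) ≠ 0 := by
    have := Real.pi_pos; positivity
  rw [warpKernel, gaussianKernel, ← two_mul]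
  rw [← two_mul] at this
  field_simp

/-- The square root and absolute value disappear, leaving products, real powers and an exponential,
to which the differentiability rules apply. -/
lemma convKernel_gaussian_eq {a : ℝ → ℝ} {s lam u v : ℝ} (hu : 0 < a u) (hv : 0 < a v) :
    convKernel a (gaussianKernel s lam) u v =
      (2 : ℝ) ^ (1 / 2 : ℝ) * a u ^ (1 / 4 : ℝ) * a v ^ (1 / 4 : ℝ) *
        (a u + a v) ^ (-(1 / 2) : ℝ) *
        (s ^ 2 * Real.exp (-(1 / lam ^ 2) * ((u - v) * (u - v) * (a u + a v) ^ (-1 : ℝ)))) := by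
  have hp : 0 < a u + a v := add_pos hu hv
  rw [convKernel, gaussianKernel, Real.rpow_neg hp.le, div_eq_mul_inv, div_pow, sq_abs,
    Real.sq_sqrt (by positivity), Real.rpow_neg_one]
  congr 3
  -- With division by zero equal to zero, both exponents vanish.
  by_cases hl : lam = 0
  · simp [hl]
  field_simp

lemma isPosDefKernel_conv {Ω : Set ℝ} {s lam : ℝ} {a : ℝ → ℝ} (hs : 0 < s) (hl : 0 < lam)
    (ha : ∀ u ∈ Ω, 0 < a u) : IsPosDefKernel Ω (convKernel a (gaussianKernel s lam)) := by
  -- The Gaussian at `u` has mean `u` and squared width `lam ^ 2 * a u`. The overlap integral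
  -- contributes `(a u * a v) ^ (1 / 2)`, which the weights `a ^ (-1 / 4)` reduce to the quarter
  -- powers of the kernel.
  refine isPosDefKernel_of_gaussBump (A := fun u => lam ^ 2 * a u) (t := fun u => u)
    (b := fun u => a u ^ (-(1 / 4) : ℝ))
    (κ := s ^ 2 * (2 : ℝ) ^ (1 / 2 : ℝ) / (Real.sqrt Real.pi * lam))
    (by have := Real.pi_pos; positivity) (fun u hu => mul_pos (by positivity) (ha u hu))
    (fun u hu => (Real.rpow_pos_of_pos (ha u hu) _).ne')
    (fun u hu v hv e => (Prod.ext_iff.1 e).2) ?_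
  intro u hu v hv
  have hau := ha u hu
  have hav := ha v hv
  rw [integral_gaussBump_mul (by positivity) (by positivity), convKernel_gaussian_eq hau hav]
  have hroot : lam * Real.sqrt (a u * a v * (a u + a v)⁻¹) =
      Real.sqrt (lam ^ 2 * (a u * a v * (a u + a v)⁻¹)) := by
    rw [Real.sqrt_mul (sq_nonneg lam), Real.sqrt_sq hl.le]
  have e₁ : Real.sqrt (Real.pi / ((lam ^ 2 * a u + lam ^ 2 * a v) /
      (lam ^ 2 * a u * (lam ^ 2 * a v)))) =
      Real.sqrt Real.pi * lam * (a u ^ (1 / 2 : ℝ) * a v ^ (1 / 2 : ℝ) *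
        (a u + a v) ^ (-(1 / 2) : ℝ)) := by
    rw [Real.rpow_neg (by positivity), ← Real.sqrt_eq_rpow, ← Real.sqrt_eq_rpow,
      ← Real.sqrt_eq_rpow, ← Real.sqrt_inv, ← Real.sqrt_mul hau.le,
      ← Real.sqrt_mul (mul_pos hau hav).le, mul_assoc (Real.sqrt Real.pi), hroot,
      ← Real.sqrt_mul Real.pi_pos.le]
    congr 1
    field_simp
  have e₂ : ∀ x : ℝ, 0 < x → x ^ (1 / 4 : ℝ) = x ^ (-(1 / 4) : ℝ) * x ^ (1 / 2 : ℝ) := by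
    intro x hx
    rw [← Real.rpow_add hx]
    norm_num
  have e₃ : -(1 / lam ^ 2) * ((u - v) * (u - v) * (a u + a v) ^ (-1 : ℝ)) =
      -(u - v) ^ 2 / (lam ^ 2 * a u + lam ^ 2 * a v) := by
    rw [Real.rpow_neg_one]
    field_simp
  have hpi : Real.sqrt Real.pi ≠ 0 := (Real.sqrt_pos.2 Real.pi_pos).ne'
  rw [e₁, e₂ _ hau, e₂ _ hav, e₃]
  field_simp

/-! ### Higher derivatives of the feature map. -/

section FeatureChain

variable {H : Type u} [NormedAddCommGroup H] [InnerProductSpace ℝ H] {Ω : Set ℝ}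

/-- The feature map of a regular kernel is differentiable as often as the kernel is in each of its
two variables. -/
lemma exists_featureMap_chain [CompleteSpace H] (hΩ : Ω.OrdConnected)
    (hne : (interior Ω).Nonempty) (q : ℕ) :
    ∀ {k : ℝ → ℝ → ℝ} {Φ : ℝ → H}, MixedReg Ω q q k →
      (∀ x ∈ Ω, ∀ y ∈ Ω, inner ℝ (Φ x) (Φ y) = k x y) →
      ∃ Ψ : ℕ → ℝ → H, Ψ 0 = Φ ∧
        ∀ j < q, ∀ x ∈ Ω, HasDerivWithinAt (Ψ j) (Ψ (j + 1) x) Ω x := by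
  induction q with
  | zero => intro k Φ _ _; exact ⟨fun _ => Φ, rfl, fun j hj => by omega⟩
  | succ q ih =>
    intro k Φ hk hΦ
    obtain ⟨k₁, d₁, r₁⟩ := hk.exists_left
    obtain ⟨k₁₂, d₁₂, r₁₂⟩ := r₁.exists_right
    obtain ⟨Φ', hd, hΦ'⟩ :=
      exists_hasDerivWithinAt_featureMap hΩ hne hΦ d₁ d₁₂ r₁₂.continuousOn
    obtain ⟨Ψ, h0, hΨ⟩ := ih r₁₂ hΦ'
    refine ⟨fun j => Nat.casesOn j Φ Ψ, rfl, ?_⟩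
    rintro (_ | j) hj x hx
    · simpa [h0] using hd x hx
    · exact hΨ j (by omega) x hx

lemma hasDerivWithinAt_inner_chain {Ψ : ℕ → ℝ → H} {q : ℕ}
    (hΨ : ∀ j < q, ∀ x ∈ Ω, HasDerivWithinAt (Ψ j) (Ψ (j + 1) x) Ω x) (f : H) :
    ∀ j < q, ∀ x ∈ Ω, HasDerivWithinAt (fun x => inner ℝ (Ψ j x) f)
      (inner ℝ (Ψ (j + 1) x) f) Ω x := by
  intro j hj x hx
  simpa using (hΨ j hj x hx).inner ℝ (hasDerivWithinAt_const x Ω f)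

/-- On the diagonal with `i = j` this gives `‖Ψ j x‖ ^ 2`, the constant in the Cauchy–Schwarz bound
for point evaluation of the `j`-th derivative. -/
lemma mixedDeriv_eq_inner (hud : UniqueDiffOn ℝ Ω) {k : ℝ → ℝ → ℝ} {Ψ : ℕ → ℝ → H} {q : ℕ}
    (hΨ : ∀ j < q, ∀ x ∈ Ω, HasDerivWithinAt (Ψ j) (Ψ (j + 1) x) Ω x)
    (hk : ∀ x ∈ Ω, ∀ y ∈ Ω, inner ℝ (Ψ 0 x) (Ψ 0 y) = k x y) {i j : ℕ} (hi : i ≤ q)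
    (hj : j ≤ q) {x y : ℝ} (hx : x ∈ Ω) (hy : y ∈ Ω) :
    mixedDeriv Ω i j k x y = inner ℝ (Ψ i x) (Ψ j y) := by
  have e : ∀ t ∈ Ω, iteratedDerivWithin j (fun y => k t y) Ω y = inner ℝ (Ψ 0 t) (Ψ j y) := by
    intro t ht
    rw [iteratedDerivWithin_congr (g := fun s => inner ℝ (Ψ 0 s) (Ψ 0 t))
        (fun s hs => by simp only; rw [real_inner_comm, hk t ht s hs]) hy, real_inner_comm]
    exact iteratedDerivWithin_eq_of_chain hud (hasDerivWithinAt_inner_chain hΨ (Ψ 0 t)) j hj y hy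
  rw [mixedDeriv, iteratedDerivWithin_congr (g := fun t => inner ℝ (Ψ 0 t) (Ψ j y)) e hx]
  exact iteratedDerivWithin_eq_of_chain hud (hasDerivWithinAt_inner_chain hΨ (Ψ j y)) i hi x hx

end FeatureChain

/-! ### Fill distance and the sampling inequality. -/

/-- Every point of an interval lies in subintervals of all small lengths. -/
lemma exists_uniform_subinterval {Ω : Set ℝ} (hΩ : Ω.OrdConnected)
    (hne : (interior Ω).Nonempty) :
    ∃ l : ℝ, 0 < l ∧ ∀ r, 0 ≤ r → r ≤ l → ∀ x ∈ Ω, ∃ α, x ∈ Icc α (α + r) ∧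
      Icc α (α + r) ⊆ Ω := by
  obtain ⟨c, hc⟩ := hne
  obtain ⟨l, hl, hsub⟩ := Metric.mem_nhds_iff.1 (mem_interior_iff_mem_nhds.1 hc)
  rw [Real.ball_eq_Ioo] at hsub
  refine ⟨l / 2, by positivity, fun r hr0 hr x hx => ?_⟩
  rcases le_total x c with h | h
  · refine ⟨x, ⟨le_rfl, by linarith⟩, ?_⟩
    have hm : c + l / 2 ∈ Ω := hsub ⟨by linarith, by linarith⟩
    exact (Icc_subset_Icc le_rfl (by linarith)).trans (hΩ.out hx hm)
  · refine ⟨x - r, ⟨by linarith, by linarith⟩, ?_⟩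
    have hm : c - l / 2 ∈ Ω := hsub ⟨by linarith, by linarith⟩
    exact (Icc_subset_Icc (by linarith) (by linarith)).trans (hΩ.out hm hx)

section FillDistance

variable {Ω : Set ℝ} {N : ℕ}

lemma iInf_abs_le_fillDistance (hb : Bornology.IsBounded Ω) (hN : 0 < N) (U : Fin N → Ω)
    {x : ℝ} (hx : x ∈ Ω) : ⨅ n : Fin N, |x - U n| ≤ fillDistance Ω U := by
  obtain ⟨M, hM⟩ := hb.exists_norm_le
  refine le_ciSup (f := fun u : Ω => ⨅ n : Fin N, |(u : ℝ) - U n|) ⟨M + M, ?_⟩ ⟨x, hx⟩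
  rintro _ ⟨v, rfl⟩
  refine (ciInf_le (Set.finite_range _).bddBelow ⟨0, hN⟩).trans ?_
  exact (abs_sub _ _).trans (add_le_add (hM _ v.2) (hM _ (U ⟨0, hN⟩).2))

lemma exists_abs_le_fillDistance (hb : Bornology.IsBounded Ω) (hN : 0 < N) (U : Fin N → Ω)
    {x : ℝ} (hx : x ∈ Ω) : ∃ n, |x - U n| ≤ fillDistance Ω U := by
  have : Nonempty (Fin N) := ⟨⟨0, hN⟩⟩
  obtain ⟨n, hn⟩ := exists_eq_ciInf_of_finite (f := fun n : Fin N => |x - U n|)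
  exact ⟨n, hn ▸ iInf_abs_le_fillDistance hb hN U hx⟩

/-- An infinite set has a point away from the finitely many sites. Positivity is what separates the
sites chosen in `exists_sites_in_interval`. -/
lemma fillDistance_pos (hb : Bornology.IsBounded Ω) (hne : (interior Ω).Nonempty) (hN : 0 < N)
    (U : Fin N → Ω) : 0 < fillDistance Ω U := by
  obtain ⟨c, hc⟩ := hne
  have hinf : Ω.Infinite := infinite_of_mem_nhds c (mem_interior_iff_mem_nhds.1 hc)
  obtain ⟨x, hx, hxU⟩ := hinf.exists_notMem_finite (Set.finite_range fun n => (U n : ℝ))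
  have : Nonempty (Fin N) := ⟨⟨0, hN⟩⟩
  obtain ⟨n, hn⟩ := exists_eq_ciInf_of_finite (f := fun n : Fin N => |x - U n|)
  refine lt_of_lt_of_le ?_ (iInf_abs_le_fillDistance hb hN U hx)
  rw [← hn]
  exact abs_pos.2 (sub_ne_zero.2 fun e => hxU ⟨n, e.symm⟩)

/-- An interval of length `4 (p + 1)` times the fill distance contains `p + 1` data sites. -/
lemma exists_sites_in_interval (hb : Bornology.IsBounded Ω) (hne : (interior Ω).Nonempty)
    (hN : 0 < N) (U : Fin N → Ω) (p : ℕ) {α : ℝ}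
    (hsub : Icc α (α + 4 * (p + 1) * fillDistance Ω U) ⊆ Ω) :
    ∃ z : ℕ → ℝ, (∀ i < p, z i < z (i + 1)) ∧
      ∀ i ≤ p, z i ∈ Icc α (α + 4 * (p + 1) * fillDistance Ω U) ∧ ∃ n, z i = U n := by
  have hh := fillDistance_pos hb hne hN U
  set h := fillDistance Ω U
  -- The targets are `4 * h` apart and each has a site within `h`, so successive sites are at least
  -- `2 * h` apart and stay in the interval.
  have hmem : ∀ i ≤ p, ∃ n, |(α + 4 * h * i + 2 * h) - U n| ≤ h := by
    intro i hi
    have hip : (i : ℝ) ≤ p := by exact_mod_cast hi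
    refine exists_abs_le_fillDistance hb hN U (hsub ⟨?_, ?_⟩)
    · have : 0 ≤ h * i := by positivity
      linarith
    · have : h * i ≤ h * p := by gcongr
      linarith
  have : Nonempty (Fin N) := ⟨⟨0, hN⟩⟩
  choose! m hm using hmem
  refine ⟨fun i => U (m i), fun i hi => ?_, fun i hi => ⟨⟨?_, ?_⟩, m i, rfl⟩⟩
  · have h1 := abs_le.1 (hm i (by omega))
    have h2 := abs_le.1 (hm (i + 1) (by omega))
    push_cast at h2
    linarith [h1.1, h2.2]
  · have h1 := abs_le.1 (hm i hi)
    have : 0 ≤ h * i := by positivity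
    linarith [h1.2]
  · have h1 := abs_le.1 (hm i hi)
    have hip : (i : ℝ) ≤ p := by exact_mod_cast hi
    have : h * i ≤ h * p := by gcongr
    linarith [h1.1]

/-- Sampling inequality: a chain of derivatives whose first member vanishes at the data sites. -/
lemma abs_chain_le_of_sites {g : ℕ → ℝ → ℝ} {p q : ℕ} (hb : Bornology.IsBounded Ω)
    (hne : (interior Ω).Nonempty) {l : ℝ}
    (hl : ∀ r, 0 ≤ r → r ≤ l → ∀ x ∈ Ω, ∃ α, x ∈ Icc α (α + r) ∧ Icc α (α + r) ⊆ Ω)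
    (hg : ∀ j < q, ∀ x ∈ Ω, HasDerivWithinAt (g j) (g (j + 1) x) Ω x) (hpq : p ≤ q)
    (hqp : q ≤ p + 1) (hN : 0 < N) (U : Fin N → Ω) (hU : ∀ n, g 0 (U n) = 0)
    (hh : 4 * (p + 1) * fillDistance Ω U ≤ l) {B : ℝ} (hB : ∀ x ∈ Ω, |g q x| ≤ B) {μ : ℕ}
    (hμ : μ ≤ q) {x : ℝ} (hx : x ∈ Ω) :
    |g μ x| ≤ (4 * (p + 1) * fillDistance Ω U) ^ (q - μ) * B := by
  have hh0 := fillDistance_pos hb hne hN U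
  obtain ⟨α, hxα, hsub⟩ := hl _ (by positivity) hh x hx
  obtain ⟨z, hz, hzU⟩ := exists_sites_in_interval hb hne hN U p hsub
  -- The `p + 1` sites give zeros for orders up to `p`, which is all that descent from order `q ≤ p
  -- + 1` needs.
  have hzero := exists_zero_of_chain hsub p g z (fun j hj => hg j (by omega)) hz
    fun i hi => ⟨(hzU i hi).1, by obtain ⟨n, hn⟩ := (hzU i hi).2; rw [hn, hU]⟩
  have := abs_chain_le hsub (r := 4 * (p + 1) * fillDistance Ω U) (M := B) (by linarith) hg
    (fun j hj => hzero j (by omega)) (fun y hy => hB y (hsub hy)) (q - μ) (by omega) x hxα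
  rwa [Nat.sub_sub_self hμ] at this

end FillDistance

/-! ### Interpolation error in the native space. -/

/-- The kernel interpolant in a Hilbert space with feature map `Φ`. -/
lemma exists_interpolant {H : Type u} [NormedAddCommGroup H] [InnerProductSpace ℝ H] {Ω : Set ℝ}
    {k : ℝ → ℝ → ℝ} {Φ : ℝ → H} (hΦ : ∀ x ∈ Ω, ∀ y ∈ Ω, inner ℝ (Φ x) (Φ y) = k x y)
    (hpd : IsPosDefKernel Ω k) {N : ℕ} (U : Fin N → Ω) (hU : Function.Injective U) (f : H) :
    ∃ m : H, (∀ x ∈ Ω, posteriorMean k 0 U (fun n => inner ℝ (Φ (U n)) f) x = inner ℝ (Φ x) m) ∧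
      (∀ n, inner ℝ (Φ (U n)) (f - m) = 0) ∧ ‖f - m‖ ≤ ‖f‖ := by
  set K : Matrix (Fin N) (Fin N) ℝ := Matrix.of fun i j => k (U i) (U j) with hK
  have hdet : IsUnit K.det := by
    rw [isUnit_iff_ne_zero]
    intro h0
    obtain ⟨v, hv, hKv⟩ := Matrix.exists_mulVec_eq_zero_iff.2 h0
    have hpos := hpd N U hU v hv
    refine hpos.ne' (Finset.sum_eq_zero fun i _ => ?_)
    have := congrFun hKv i
    simp only [Matrix.mulVec, dotProduct, hK, Matrix.of_apply, Pi.zero_apply] at this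
    calc ∑ j, v i * v j * k (U i) (U j) = v i * ∑ j, k (U i) (U j) * v j := by
          rw [Finset.mul_sum]
          exact Finset.sum_congr rfl fun j _ => by ring
      _ = 0 := by rw [this, mul_zero]
  set y : Fin N → ℝ := fun n => inner ℝ (Φ (U n)) f with hy
  set c : Fin N → ℝ := K⁻¹.mulVec y with hc
  have hKc : K.mulVec c = y := by
    rw [hc, Matrix.mulVec_mulVec, Matrix.mul_nonsing_inv _ hdet, Matrix.one_mulVec]
  set m : H := ∑ n, c n • Φ (U n) with hm
  have hin : ∀ x ∈ Ω, inner ℝ (Φ x) m = ∑ n, k x (U n) * c n := by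
    intro x hx
    rw [hm, inner_sum]
    refine Finset.sum_congr rfl fun n _ => ?_
    rw [inner_smul_right, hΦ x hx _ (U n).2, mul_comm]
  have horth : ∀ n, inner ℝ (Φ (U n)) (f - m) = 0 := by
    intro n
    rw [inner_sub_right, hin _ (U n).2, sub_eq_zero]
    exact (congrFun hKc n).symm
  refine ⟨m, fun x hx => ?_, horth, ?_⟩
  · rw [hin x hx, posteriorMean, zero_smul, add_zero]
    rfl
  -- `m` lies in the span of the `Φ (U n)`, to which `f - m` is orthogonal; Pythagoras gives the
  -- norm bound.
  · have h0 : inner ℝ m (f - m) = 0 := by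
      conv_lhs => rw [hm]
      rw [sum_inner]
      exact Finset.sum_eq_zero fun n _ => by rw [inner_smul_left, horth, mul_zero]
    have h1 : ‖f‖ ^ 2 = ‖f - m‖ ^ 2 + ‖m‖ ^ 2 := by
      have := norm_add_sq_real m (f - m)
      rw [h0, add_sub_cancel] at this
      linarith
    exact le_of_sq_le_sq (by linarith [sq_nonneg ‖m‖]) (norm_nonneg f)

/-- Error bound for kernel interpolation: `D` and `M` bound the derivatives of orders `p` and
`p + 1` on the unit ball of the native space. -/
lemma nativeErrorBound_of_mixedReg {Ω : Set ℝ} (hb : Bornology.IsBounded Ω)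
    (hΩ : Ω.OrdConnected) (hne : (interior Ω).Nonempty) {p : ℕ} {k : ℝ → ℝ → ℝ}
    (hk : MixedReg Ω (p + 1) (p + 1) k) (hpd : IsPosDefKernel Ω k) {l : ℝ}
    (hl : ∀ r, 0 ≤ r → r ≤ l → ∀ x ∈ Ω, ∃ α, x ∈ Icc α (α + r) ∧ Icc α (α + r) ⊆ Ω)
    {D M : ℝ} (hD0 : 0 ≤ D) (hM0 : 0 ≤ M) (hD : ∀ x ∈ Ω, mixedDeriv Ω p p k x x ≤ D ^ 2)
    (hM : ∀ x ∈ Ω, mixedDeriv Ω (p + 1) (p + 1) k x x ≤ M ^ 2) {C h₀ : ℝ}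
    (hh₀ : 4 * (p + 1) * h₀ ≤ l)
    (hC : (4 * (p + 1) : ℝ) ^ p * D ≤ C ∨ (4 * (p + 1) : ℝ) ^ (p + 1) * h₀ * M ≤ C) :
    NativeErrorBound.{u} Ω p k C h₀ := by
  classical
  intro H _ _ _ _ hker f
  have hud : UniqueDiffOn ℝ Ω := uniqueDiffOn_convex hΩ.convex hne
  -- The feature map is extended by zero to all reals so that derivatives within `Ω` make sense.
  set Φ : ℝ → H := fun x => if hx : x ∈ Ω then RKHS.kerFun H (⟨x, hx⟩ : Ω) 1 else 0 with hΦdef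
  have hΦf : ∀ x : Ω, ∀ f : H, inner ℝ (Φ x) f = f x := by
    intro x f
    simp [hΦdef, x.2]
  have hΦ : ∀ x ∈ Ω, ∀ y ∈ Ω, inner ℝ (Φ x) (Φ y) = k x y := by
    intro x hx y hy
    have := hΦf ⟨x, hx⟩ (Φ y)
    simp only at this
    rw [this, ← hker ⟨x, hx⟩ ⟨y, hy⟩, ← RKHS.kerFun_apply]
    simp [hΦdef, hy]
  clear_value Φ
  obtain ⟨Ψ, rfl, hΨ⟩ := exists_featureMap_chain hΩ hne (p + 1) hk hΦ
  have hext : ∀ f : H, EqOn (extendZero Ω f) (fun x => inner ℝ (Ψ 0 x) f) Ω := by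
    intro f x hx
    have := hΦf ⟨x, hx⟩ f
    simp only at this ⊢
    rw [this]
    exact Subtype.val_injective.extend_apply f 0 ⟨x, hx⟩
  have hder : ∀ f : H, ∀ μ ≤ p + 1, ∀ x ∈ Ω,
      iteratedDerivWithin μ (fun x => inner ℝ (Ψ 0 x) f) Ω x = inner ℝ (Ψ μ x) f :=
    fun f μ hμ x hx =>
      iteratedDerivWithin_eq_of_chain hud (hasDerivWithinAt_inner_chain hΨ f) μ hμ x hx
  have hbound : ∀ j ≤ p + 1, ∀ D : ℝ, 0 ≤ D → (∀ x ∈ Ω, mixedDeriv Ω j j k x x ≤ D ^ 2) →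
      ∀ e : H, ∀ x ∈ Ω, |inner ℝ (Ψ j x) e| ≤ D * ‖e‖ := by
    intro j hj D hD0 hD e x hx
    refine (abs_real_inner_le_norm _ _).trans ?_
    gcongr
    refine le_of_sq_le_sq ?_ hD0
    rw [← real_inner_self_eq_norm_sq, ← mixedDeriv_eq_inner hud hΨ hΦ hj hj hx hx]
    exact hD x hx
  refine ⟨(contDiffOn_of_chain hud p.lt_succ_self (hasDerivWithinAt_inner_chain hΨ f)).congr
    (hext f), fun N U hN hU hfill μ hμ x hx => ?_⟩
  obtain ⟨m, hm, horth, hnorm⟩ := exists_interpolant hΦ hpd U hU f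
  simp_rw [hΦf] at hm
  have hE : iteratedDerivWithin μ (extendZero Ω f) Ω x -
      iteratedDerivWithin μ (posteriorMean k 0 U fun n => f (U n)) Ω x =
      inner ℝ (Ψ μ x) (f - m) := by
    rw [iteratedDerivWithin_congr (hext f) hx, iteratedDerivWithin_congr (g := fun x =>
      inner ℝ (Ψ 0 x) m) hm hx, hder f μ (by omega) x hx, hder m μ (by omega) x hx,
      inner_sub_right]
  rw [hE]
  have hh := fillDistance_pos hb hne hN U
  set h := fillDistance Ω U with hhdef
  have hR : (1 : ℝ) ≤ 4 * (p + 1) := by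
    have : (0 : ℝ) ≤ p := p.cast_nonneg
    linarith
  have hhl : 4 * (p + 1) * h ≤ l := le_trans (by gcongr) hh₀
  have hg := hasDerivWithinAt_inner_chain hΨ (f - m)
  refine le_trans ?_ (mul_le_mul_of_nonneg_left hnorm (?_ : 0 ≤ C * h ^ (p - μ)))
  · rcases hC with hC | hC
    · refine (abs_chain_le_of_sites hb hne hl (fun j hj => hg j (by omega)) le_rfl p.le_succ hN U
        horth hhl (hbound p p.le_succ D hD0 hD (f - m)) hμ.le hx).trans ?_
      rw [← mul_assoc]
      refine mul_le_mul_of_nonneg_right ?_ (norm_nonneg _)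
      calc (4 * (p + 1) * h) ^ (p - μ) * D
          = (4 * (p + 1) : ℝ) ^ (p - μ) * D * h ^ (p - μ) := by rw [mul_pow]; ring
        _ ≤ (4 * (p + 1) : ℝ) ^ p * D * h ^ (p - μ) := by gcongr; omega
        _ ≤ C * h ^ (p - μ) := by gcongr
    -- Descent from order `p + 1` leaves one spare factor `h ≤ h₀`, which joins the constant.
    · refine (abs_chain_le_of_sites hb hne hl hg p.le_succ le_rfl hN U
        horth hhl (hbound (p + 1) le_rfl M hM0 hM (f - m)) (by omega) hx).trans ?_
      rw [← mul_assoc]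
      refine mul_le_mul_of_nonneg_right ?_ (norm_nonneg _)
      have e : p + 1 - μ = p - μ + 1 := by omega
      calc (4 * (p + 1) * h) ^ (p + 1 - μ) * M
          = (4 * (p + 1) : ℝ) ^ (p + 1 - μ) * h * M * h ^ (p - μ) := by
            rw [mul_pow, e, pow_succ h]; ring
        _ ≤ (4 * (p + 1) : ℝ) ^ (p + 1) * h₀ * M * h ^ (p - μ) := by gcongr; omega
        _ ≤ C * h ^ (p - μ) := by gcongr
  · have hC0 : 0 ≤ C := by
      have : 0 ≤ h₀ := hh.le.trans hfill
      rcases hC with hC | hC <;> exact le_trans (by positivity) hC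
    positivity

lemma NativeErrorBound.mono {Ω : Set ℝ} {p : ℕ} {k : ℝ → ℝ → ℝ} {C h h' : ℝ} (hh : h ≤ h')
    (H : NativeErrorBound.{u} Ω p k C h') : NativeErrorBound.{u} Ω p k C h := by
  intro F _ _ _ _ hF f
  obtain ⟨h1, h2⟩ := H F hF f
  exact ⟨h1, fun N U hN hU hf => h2 N U hN hU (hf.trans hh)⟩

section DerivConst

variable {Ω : Set ℝ} {p : ℕ} {k : ℝ → ℝ → ℝ}

lemma derivConst_nonneg : 0 ≤ derivConst Ω p k := by
  refine Real.sSup_nonneg ?_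
  rintro _ ⟨a, b, _, u, _, v, _, rfl⟩
  exact abs_nonneg _

/-- The supremum is only meaningful for a bounded set; regularity `2p` in each variable bounds every
order with `a + b = 2p`. -/
lemma mixedDeriv_le_derivConst (hud : UniqueDiffOn ℝ Ω) (hk : MixedReg Ω (2 * p) (2 * p) k)
    {x y : ℝ} (hx : x ∈ Ω) (hy : y ∈ Ω) : mixedDeriv Ω p p k x y ≤ derivConst Ω p k := by
  have hbdd : BddAbove (⋃ a ∈ Finset.range (2 * p + 1), ⋃ b ∈ Finset.range (2 * p + 1),
      {x : ℝ | ∃ u ∈ Ω, ∃ v ∈ Ω, x = |mixedDeriv Ω a b k u v|}) := by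
    refine ((Finset.range (2 * p + 1)).finite_toSet.bddAbove_biUnion).2 fun a ha =>
      ((Finset.range (2 * p + 1)).finite_toSet.bddAbove_biUnion).2 fun b hb => ?_
    simp only [Finset.coe_range, mem_Iio] at ha hb
    exact hk.bddAbove_mixedDeriv hud (by omega) (by omega)
  refine (le_abs_self _).trans (le_csSup (hbdd.mono ?_) ⟨p, p, by omega, x, hx, y, hy, rfl⟩)
  rintro _ ⟨a, b, hab, u, hu, v, hv, rfl⟩
  simp only [mem_iUnion]
  exact ⟨a, Finset.mem_range.2 (by omega), b, Finset.mem_range.2 (by omega), u, hu, v, hv, rfl⟩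

end DerivConst

/-- For a regular kernel, the error bound holds with a constant proportional to the square root of
`derivConst` for small fill distances; since the derivatives of order `p + 1` are controlled as
well, every positive constant is admissible for sufficiently small fill distances. -/
lemma exists_nativeErrorBound {Ω : Set ℝ} (hb : Bornology.IsBounded Ω) (hΩ : Ω.OrdConnected)
    (hne : (interior Ω).Nonempty) {p : ℕ} (hp : 1 ≤ p) :
    ∃ A h₁ : ℝ, 0 < A ∧ 0 < h₁ ∧ ∀ k : ℝ → ℝ → ℝ, MixedReg Ω (2 * p) (2 * p) k →
      IsPosDefKernel Ω k →
      NativeErrorBound.{u} Ω p k (A * Real.sqrt (derivConst Ω p k)) h₁ ∧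
      ∀ C : ℝ, 0 < C → ∃ h₀ : ℝ, 0 < h₀ ∧ NativeErrorBound.{u} Ω p k C h₀ := by
  have hud : UniqueDiffOn ℝ Ω := uniqueDiffOn_convex hΩ.convex hne
  obtain ⟨l, hl0, hl⟩ := exists_uniform_subinterval hΩ hne
  have hR : (0 : ℝ) < 4 * (p + 1) := by positivity
  -- Both constants come from `p` and the length `l`, which depends on `Ω` alone, so they are fixed
  -- before the kernel.
  refine ⟨(4 * (p + 1) : ℝ) ^ p, l / (4 * (p + 1)), by positivity, by positivity,
    fun k hk hpd => ?_⟩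
  -- This is where `1 ≤ p` enters, as `p + 1 ≤ 2 * p`.
  have hk' : MixedReg Ω (p + 1) (p + 1) k := hk.mono (by omega) (by omega)
  obtain ⟨M₀, hM₀⟩ := (hk'.mono (m := 0 + (p + 1)) (n := 0 + (p + 1)) (by omega)
    (by omega)).mixedDeriv hud |>.bounded
  set M := max M₀ 1 with hMdef
  have hM1 : 1 ≤ M := le_max_right _ _
  have hM : ∀ x ∈ Ω, mixedDeriv Ω (p + 1) (p + 1) k x x ≤ M ^ 2 := fun x hx =>
    ((le_abs_self _).trans ((hM₀ x hx x hx).trans (le_max_left _ _))).trans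
      (le_self_pow₀ hM1 two_ne_zero)
  have hD : ∀ x ∈ Ω, mixedDeriv Ω p p k x x ≤ Real.sqrt (derivConst Ω p k) ^ 2 := fun x hx => by
    rw [Real.sq_sqrt derivConst_nonneg]
    exact mixedDeriv_le_derivConst hud hk hx hx
  refine ⟨nativeErrorBound_of_mixedReg hb hΩ hne hk' hpd hl (Real.sqrt_nonneg _)
    (by linarith) hD hM (mul_div_cancel₀ _ hR.ne').le (Or.inl le_rfl), fun C hC => ?_⟩
  have hM0 : 0 < M := by linarith
  -- The first entry makes the sampling intervals fit into `Ω`; the second solves `(4 * (p + 1)) ^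
  -- (p + 1) * h₀ * M ≤ C`.
  refine ⟨min (l / (4 * (p + 1))) (C / ((4 * (p + 1)) ^ (p + 1) * M)), by positivity,
    nativeErrorBound_of_mixedReg hb hΩ hne hk' hpd hl (Real.sqrt_nonneg _) hM0.le hD hM
      ?_ (Or.inr ?_)⟩
  · rw [← le_div_iff₀' hR]
    exact min_le_left _ _
  · rw [mul_right_comm, ← le_div_iff₀' (by positivity)]
    exact min_le_right _ _

/-! ### Norms and positivity of the constants -/

section Norm

variable {Ω : Set ℝ} {m : ℕ} {g : ℝ → ℝ}

lemma abs_le_cNorm (hg : IsCm Ω m g) {x : ℝ} (hx : x ∈ Ω) : |g x| ≤ cNorm Ω m g := by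
  have h0 : |g x| ≤ sSup {x : ℝ | ∃ u ∈ Ω, x = |iteratedDerivWithin 0 g Ω u|} :=
    le_csSup (hg.2 0 m.zero_le) ⟨x, hx, by simp⟩
  exact h0.trans (Finset.single_le_sum
    (f := fun j => sSup {x : ℝ | ∃ u ∈ Ω, x = |iteratedDerivWithin j g Ω u|})
    (fun j _ => Real.sSup_nonneg (by rintro _ ⟨u, _, rfl⟩; exact abs_nonneg _))
    (Finset.mem_range.2 m.succ_pos))

lemma cNorm_pos (hg : IsCm Ω m g) {x : ℝ} (hx : x ∈ Ω) (hgx : g x ≠ 0) : 0 < cNorm Ω m g :=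
  (abs_pos.2 hgx).trans_le (abs_le_cNorm hg hx)

end Norm

lemma bell_pos (n : ℕ) : 0 < Nat.bell n := by
  induction n using Nat.strong_induction_on with
  | _ n ih =>
    rcases n with _ | n
    · simp
    rw [Nat.bell_succ]
    exact Finset.sum_pos (fun i hi => Nat.mul_pos (Nat.choose_pos (Finset.mem_Iic.1 hi))
      (ih _ (by omega))) ⟨0, by simp⟩

/-! ### The three kernel families. -/

namespace NonstatKernel

variable {Ω : Set ℝ} {p : ℕ} {θ : NonstatKernel}

lemma Admissible.isPosDefKernel (h : θ.Admissible Ω p) : IsPosDefKernel Ω θ.kernel := by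
  cases θ with
  | warp s lam w => exact isPosDefKernel_warp h.1 h.2.1 h.2.2.1
  | mix L s lam σ => exact h.2
  | conv s lam c a =>
    exact isPosDefKernel_conv h.1 h.2.1 fun u hu => h.2.2.1.trans_le (h.2.2.2.1 u hu)

lemma Admissible.mixedReg (hb : Bornology.IsBounded Ω) (hud : UniqueDiffOn ℝ Ω)
    (h : θ.Admissible Ω p) : MixedReg Ω (2 * p) (2 * p) θ.kernel := by
  have hgauss : ∀ (s lam : ℝ) {d : ℝ → ℝ → ℝ}, MixedReg Ω (2 * p) (2 * p) d →
      MixedReg Ω (2 * p) (2 * p) (fun u v => gaussianKernel s lam (d u v)) := by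
    intro s lam d hd
    refine (((hd.mul hd).const_mul (-(1 / (2 * lam ^ 2)))).exp.const_mul (s ^ 2)).congr
      fun x _ y _ => ?_
    rw [gaussianKernel]
    ring_nf
  have hid : MixedReg Ω (2 * p) (2 * p) (fun u v => u - v) :=
    (MixedReg.fst hb).sub (MixedReg.snd hb)
  cases θ with
  | warp s lam w =>
    exact hgauss s lam ((MixedReg.of_isCm_left hud h.2.2.2).sub
      (MixedReg.of_isCm_right hud h.2.2.2))
  | mix L s lam σ =>
    exact MixedReg.sum Finset.univ fun l _ =>
      ((MixedReg.of_isCm_left hud (h.1 l).2.2).mul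
        (MixedReg.of_isCm_right hud (h.1 l).2.2)).mul (hgauss (s l) (lam l) hid)
  | conv s lam c a =>
    obtain ⟨_, _, hc, hca, ha⟩ := h
    have ha₁ := MixedReg.of_isCm_left (n := 2 * p) hud ha
    have ha₂ := MixedReg.of_isCm_right (m := 2 * p) hud ha
    have hsum : ∀ x ∈ Ω, ∀ y ∈ Ω, c + c ≤ a x + a y :=
      fun x hx y hy => add_le_add (hca x hx) (hca y hy)
    have hcc : 0 < c + c := by linarith
    refine (((((ha₁.rpow hc (1 / 4) fun x hx _ _ => hca x hx).const_mul
      ((2 : ℝ) ^ (1 / 2 : ℝ))).mul (ha₂.rpow hc (1 / 4) fun _ _ y hy => hca y hy)).mul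
      ((ha₁.add ha₂).rpow hcc (-(1 / 2)) hsum)).mul
      ((((hid.mul hid).mul ((ha₁.add ha₂).rpow hcc (-1) hsum)).const_mul
        (-(1 / lam ^ 2))).exp.const_mul (s ^ 2))).congr fun x hx y hy => ?_
    exact convKernel_gaussian_eq (hc.trans_le (hca x hx)) (hc.trans_le (hca y hy))

lemma Admissible.contDiffOn (h : θ.Admissible Ω p) :
    ContDiffOn ℝ (2 * p : ℕ) (fun z : ℝ × ℝ => θ.kernel z.1 z.2) (Ω ×ˢ Ω) := by
  have h₁ : ∀ {g : ℝ → ℝ}, IsCm Ω (2 * p) g →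
      ContDiffOn ℝ (2 * p : ℕ) (fun z : ℝ × ℝ => g z.1) (Ω ×ˢ Ω) :=
    fun hg => hg.1.comp contDiffOn_fst fun z hz => hz.1
  have h₂ : ∀ {g : ℝ → ℝ}, IsCm Ω (2 * p) g →
      ContDiffOn ℝ (2 * p : ℕ) (fun z : ℝ × ℝ => g z.2) (Ω ×ˢ Ω) :=
    fun hg => hg.1.comp contDiffOn_snd fun z hz => hz.2
  have hgauss : ∀ s lam : ℝ, ContDiff ℝ (2 * p : ℕ) (gaussianKernel s lam) := by
    intro s lam
    unfold gaussianKernel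
    fun_prop
  cases θ with
  | warp s lam w => exact (hgauss s lam).comp_contDiffOn ((h₁ h.2.2.2).sub (h₂ h.2.2.2))
  | mix L s lam σ =>
    simp only [kernel, mixKernel]
    exact ContDiffOn.sum fun l _ => ((h₁ (h.1 l).2.2).mul (h₂ (h.1 l).2.2)).mul
      ((hgauss (s l) (lam l)).comp_contDiffOn (contDiffOn_fst.sub contDiffOn_snd))
  | conv s lam c a =>
    obtain ⟨_, _, hc, hca, ha⟩ := h
    have hpos : ∀ x ∈ Ω, 0 < a x := fun x hx => hc.trans_le (hca x hx)
    have hsum := (h₁ ha).add (h₂ ha)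
    have hne : ∀ z ∈ Ω ×ˢ Ω, a z.1 + a z.2 ≠ 0 :=
      fun z hz => (add_pos (hpos _ hz.1) (hpos _ hz.2)).ne'
    have hdiff : ContDiffOn ℝ (2 * p : ℕ) (fun z : ℝ × ℝ => z.1 - z.2) (Ω ×ˢ Ω) :=
      contDiffOn_fst.sub contDiffOn_snd
    refine ((((contDiffOn_const (c := (2 : ℝ) ^ (1 / 2 : ℝ))).mul ((h₁ ha).rpow_const_of_ne
      (p := 1 / 4) fun z hz => (hpos _ hz.1).ne')).mul ((h₂ ha).rpow_const_of_ne
      (p := 1 / 4) fun z hz => (hpos _ hz.2).ne')).mul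
      (hsum.rpow_const_of_ne (p := -(1 / 2)) hne)).mul
      ((contDiffOn_const (c := s ^ 2)).mul ((contDiffOn_const (c := -(1 / lam ^ 2))).mul
        ((hdiff.mul hdiff).mul (hsum.rpow_const_of_ne (p := -1) hne))).exp) |>.congr
      fun z hz => ?_
    exact convKernel_gaussian_eq (hpos _ hz.1) (hpos _ hz.2)

/-- Each constant is a product of positive factors once the hyper-parameters are not identically
zero: an injective `w` has at most one zero, positive definiteness at one point forces some `σ l x ≠
0`, and `a ≥ c > 0`. -/
lemma Admissible.explicitConst_pos {C₀ : ℝ} (hC₀ : 0 < C₀) (hne : (interior Ω).Nonempty)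
    (hp : 1 ≤ p) (h : θ.Admissible Ω p) : 0 < θ.explicitConst C₀ Ω p := by
  obtain ⟨x, hxi⟩ := hne
  have hx : x ∈ Ω := interior_subset hxi
  have hbell : (0 : ℝ) < Nat.bell (2 * p) := by exact_mod_cast bell_pos _
  have hp0 : (0 : ℝ) < p := by exact_mod_cast hp
  cases θ with
  | warp s lam w =>
    obtain ⟨hs, _, hinj, hw⟩ := h
    have hinf : Ω.Infinite := infinite_of_mem_nhds x (mem_interior_iff_mem_nhds.1 hxi)
    obtain ⟨y, hy, hyx⟩ := hinf.exists_notMem_finite (Set.finite_singleton x)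
    have hpos : 0 < cNorm Ω (2 * p) w := by
      by_cases hwx : w x = 0
      · exact cNorm_pos hw hy fun hwy => hyx (hinj hy hx (hwy.trans hwx.symm))
      · exact cNorm_pos hw hx hwx
    simp only [explicitConst]
    positivity
  | mix L s lam σ =>
    obtain ⟨hσ, hpd⟩ := h
    obtain ⟨l, hl⟩ : ∃ l, σ l x ≠ 0 := by
      by_contra! h0
      have := hpd 1 (fun _ => ⟨x, hx⟩) (Function.injective_of_subsingleton _) (fun _ => 1)
        (fun e => one_ne_zero (congrFun e 0))
      simp [kernel, mixKernel, h0] at this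
    have hsup : 0 < ⨆ ℓ, cNorm Ω (2 * p) (σ ℓ) ^ 2 :=
      (pow_pos (cNorm_pos (hσ l).2.2 hx hl) 2).trans_le
        (le_ciSup (f := fun ℓ => cNorm Ω (2 * p) (σ ℓ) ^ 2) (Set.finite_range _).bddAbove l)
    simp only [explicitConst]
    positivity
  | conv s lam c a =>
    obtain ⟨hs, _, hc, hca, ha⟩ := h
    have hpos : 0 < cNorm Ω (2 * p) a := cNorm_pos ha hx (hc.trans_le (hca x hx)).ne'
    have h54 : 0 < |5 / 4 - 2 * (p : ℝ)| := by
      have : (1 : ℝ) ≤ p := by exact_mod_cast hp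
      exact abs_pos.2 (by linarith)
    have hmax : 0 < max (cNorm Ω 0 a) 1 := lt_max_of_lt_right one_pos
    simp only [explicitConst]
    positivity

end NonstatKernel

end

theorem corollary5p5 :
    ∃ C₀ : ℝ, 0 < C₀ ∧ C₀ ≤ 1.0866 ∧
      ∀ Ω : Set ℝ, Bornology.IsBounded Ω → Ω.OrdConnected → (interior Ω).Nonempty →
      ∀ p : ℕ, 1 ≤ p →
      ∃ A h₁ : ℝ, 0 < A ∧ 0 < h₁ ∧
      ∀ θ : NonstatKernel, θ.Admissible Ω p →
        IsPosDefKernel Ω θ.kernel ∧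
        IsCm₂ Ω (2 * p) θ.kernel ∧
        NativeErrorBound.{u} Ω p θ.kernel (A * Real.sqrt (derivConst Ω p θ.kernel)) h₁ ∧
        ∃ h₀ : ℝ, 0 < h₀ ∧
          NativeErrorBound.{u} Ω p θ.kernel (derivConst Ω p θ.kernel) h₀ ∧
          NativeErrorBound.{u} Ω p θ.kernel (θ.explicitConst C₀ Ω p) h₀ := by
  -- Any positive value up to 1.0866 would serve, since only the positivity of `explicitConst` is
  -- used.
  refine ⟨1, one_pos, by norm_num, fun Ω hb hΩ hne p hp => ?_⟩
  have hud : UniqueDiffOn ℝ Ω := uniqueDiffOn_convex hΩ.convex hne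
  obtain ⟨A, h₁, hA, hh₁, H⟩ := exists_nativeErrorBound.{u} hb hΩ hne hp
  refine ⟨A, h₁, hA, hh₁, fun θ hθ => ?_⟩
  have hreg := hθ.mixedReg hb hud
  obtain ⟨hsqrt, hpos⟩ := H θ.kernel hreg hθ.isPosDefKernel
  refine ⟨hθ.isPosDefKernel, ⟨hθ.contDiffOn, fun a b hab =>
    hreg.bddAbove_mixedDeriv hud (by omega) (by omega)⟩, hsqrt, ?_⟩
  obtain ⟨hE, hE0, hEbound⟩ := hpos _ (hθ.explicitConst_pos one_pos hne hp)
  obtain ⟨hD, hD0, hDbound⟩ : ∃ h₀ : ℝ, 0 < h₀ ∧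
      NativeErrorBound.{u} Ω p θ.kernel (derivConst Ω p θ.kernel) h₀ := by
    -- A vanishing `derivConst` is not a positive constant, but then the square-root bound has
    -- constant zero as well.
    rcases derivConst_nonneg.eq_or_lt' with h0 | h0
    · rw [h0, Real.sqrt_zero, mul_zero] at hsqrt
      exact ⟨h₁, hh₁, by rwa [h0]⟩
    · exact hpos _ h0
  exact ⟨min hD hE, lt_min hD0 hE0, hDbound.mono (min_le_left _ _),
    hEbound.mono (min_le_right _ _)⟩
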